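/- \textbf{Setting.} Let $T_1,T_2>0$, let $\mathcal T^2=\mathbb R^2/(T_1\mathbb Z\times T_2\mathbb Z)$, and let $P=(p_1,p_2)^{\mathsf T}\in\mathbb R^2$ have rationally independent components. Let $\mathcal E:\mathcal T^2\to\mathbb R$ be continuous with $\mathcal E(\mathbf x)>0$ for all $\mathbf x\in\mathcal T^2$, and let $\varepsilon(r)=\mathcal E(Pr)$, $r\in\mathbb R$, be the corresponding quasiperiodic coefficient. For a densely defined linear operator $A$ on a Hilbert space $H$ and a bounded operator $B$ on $H$, the spectrum $\sigma(A,B)\subseteq\mathbb C$ of the pair is the set of all $\lambda\in\mathbb C$ for which $A-\lambda B:\mathrm{dom}(A)\to H$ is not a bijection with bounded inverse. Let $\nabla_r^2=\frac{d^2}{dr^2}$ on $L^2(\mathbb R;\mathbb C)$ with domain $H^2(\mathbb R)$. For $\mathbf k\in\mathbb R^2$ let $(\nabla_P+\imath P^{\mathsf T}\mathbf k)^2$, where $\nabla_P=p_1\partial_{x_1}+p_2\partial_{x_2}$, be the operator on $L^2(\mathcal T^2;\mathbb C)$ that acts on Fourier series by $$\sum_{\boldsymbol\xi}U_{\boldsymbol\xi}e^{\imath\boldsymbol\xi\cdot\mathbf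 x}\;\longmapsto\;\sum_{\boldsymbol\xi}\bigl(\imath P^{\mathsf T}(\boldsymbol\xi+\mathbf k)\bigr)^2U_{\boldsymbol\xi}e^{\imath\boldsymbol\xi\cdot\mathbf x},\qquad \boldsymbol\xi\in\tfrac{2\pi}{T_1}\mathbb Z\times\tfrac{2\pi}{T_2}\mathbb Z,$$ on its maximal domain. The functions $\varepsilon$ and $\mathcal E$ act as multiplication operators on $L^2(\mathbb R)$ and $L^2(\mathcal T^2)$. Let $\mathbf B=[-\pi/T_1,\pi/T_1]\times[-\pi/T_2,\pi/T_2]$ be the Brillouin zone. \textbf{Theorem.} It holds that $$\sigma\bigl(\nabla_r^2,\varepsilon(r)\bigr)\subseteq\overline{\bigcup_{\mathbf k\in\mathbf B}\sigma\Bigl((\nabla_P+\imath P^{\mathsf T}\mathbf k)^2,\mathcal E(\mathbf x)\Bigr)}.$$ -/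

import Mathlib

open MeasureTheory SchwartzMap
open scoped ENNReal BoundedContinuousFunction

noncomputable section

/-! ### Spectrum of an operator pair -/

section Pencil

variable {H : Type*} [NormedAddCommGroup H] [NormedSpace ℂ H]

/-- The resolvent set of the operator pair `(A, B)`, with `A` a (possibly unbounded) linear operator
and `B` a bounded one: the `z : ℂ` for which `A - z B`, defined on the domain of `A`, is a bijection
onto the whole space with a bounded inverse `R`. -/
def pairResolventSet (A : H →ₗ.[ℂ] H) (B : H →L[ℂ] H) : Set ℂ :=
  {z | ∃ R : H →L[ℂ] H,
    (∀ f : H, ∃ h : R f ∈ A.domain, A ⟨R f, h⟩ - z • B (R f) = f) ∧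
    ∀ u : A.domain, R (A u - z • B u) = u}

/-- The spectrum `σ(A, B)` of the operator pair, i.e. of the generalized eigenvalue problem
`A u = z B u`. -/
def pairSpectrum (A : H →ₗ.[ℂ] H) (B : H →L[ℂ] H) : Set ℂ :=
  (pairResolventSet A B)ᶜ

end Pencil

/-! ### Multiplication operators on `L²` -/

section Mul

variable {X : Type*} [TopologicalSpace X] [MeasurableSpace X] [OpensMeasurableSpace X]

theorem memLp_top_coe (μ : Measure X) (g : X →ᵇ ℝ) : MemLp (fun x => (g x : ℂ)) ∞ μ :=
  memLp_top_of_bound (Complex.measurable_ofReal.comp g.continuous.measurable).aestronglyMeasurable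
    ‖g‖ (Filter.Eventually.of_forall fun x => by
      simpa using g.norm_coe_le_norm x)

/-- Multiplication by a bounded continuous real function `g`, as a bounded operator on
`L²(X, μ; ℂ)`. -/
def mulOp (μ : Measure X) (g : X →ᵇ ℝ) : Lp ℂ 2 μ →L[ℂ] Lp ℂ 2 μ :=
  (ContinuousLinearMap.mul ℂ ℂ).holderL μ ∞ 2 2 (memLp_top_coe μ g).toLp

theorem mulOp_ae (μ : Measure X) (g : X →ᵇ ℝ) (u : Lp ℂ 2 μ) :
    mulOp μ g u =ᵐ[μ] fun x => (g x : ℂ) * u x := by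
  have h1 := (ContinuousLinearMap.mul ℂ ℂ).coeFn_holder (r := 2) (memLp_top_coe μ g).toLp u
  have h2 := (memLp_top_coe μ g).coeFn_toLp
  filter_upwards [h1, h2] with x hx1 hx2
  change ((ContinuousLinearMap.mul ℂ ℂ).holder 2 (memLp_top_coe μ g).toLp u) x = _
  rw [hx1, hx2]
  simp

end Mul

/-! ### The operator `∇_r² = d²/dr²` on the line -/

/-- `L²(ℝ; ℂ)`. -/
abbrev LineL2 : Type := Lp ℂ 2 (volume : Measure ℝ)

/-- The graph of `d²/dr²` in `L²(ℝ)`: pairs `(u, w)` with `u'' = w` in the sense of (tempered)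
distributions. -/
def lineLaplacianGraph : Submodule ℂ (LineL2 × LineL2) where
  carrier := {q | TemperedDistribution.derivCLM ℂ (TemperedDistribution.derivCLM ℂ
      (Lp.toTemperedDistributionCLM ℂ volume 2 q.1)) =
    Lp.toTemperedDistributionCLM ℂ volume 2 q.2}
  add_mem' := by
    intro a b ha hb
    simp only [Set.mem_ofPred_eq, Prod.fst_add, Prod.snd_add, map_add] at *
    rw [ha, hb]
  zero_mem' := by
    simp only [Set.mem_ofPred_eq, Prod.fst_zero, Prod.snd_zero, map_zero]
  smul_mem' := by
    intro c a ha
    simp only [Set.mem_ofPred_eq, Prod.smul_fst, Prod.smul_snd, map_smul] at *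
    rw [ha]

theorem lineLaplacianGraph_unique (q : LineL2 × LineL2) (hq : q ∈ lineLaplacianGraph)
    (h0 : q.1 = 0) : q.2 = 0 := by
  have h : TemperedDistribution.derivCLM ℂ (TemperedDistribution.derivCLM ℂ
      (Lp.toTemperedDistributionCLM ℂ volume 2 q.1)) =
    Lp.toTemperedDistributionCLM ℂ volume 2 q.2 := hq
  rw [h0, map_zero, map_zero, map_zero] at h
  have hk : q.2 ∈ (Lp.toTemperedDistributionCLM ℂ (volume : Measure ℝ) 2).ker := h.symm
  rw [Lp.ker_toTemperedDistributionCLM_eq_bot] at hk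
  simpa using hk

/-- The operator `∇_r² = d²/dr²` on `L²(ℝ)`, with domain `{u ∈ L² | u'' ∈ L²} = H²(ℝ)`. -/
def lineLaplacian : LineL2 →ₗ.[ℂ] LineL2 := lineLaplacianGraph.toLinearPMap

theorem lineLaplacian_graph : lineLaplacian.graph = lineLaplacianGraph :=
  Submodule.toLinearPMap_graph_eq _ lineLaplacianGraph_unique

/-! ### The torus -/

/-- The torus `𝒯² = ℝ² / (T₁ ℤ × T₂ ℤ)`, carrying Lebesgue measure (of total mass `T₁ T₂`). -/
abbrev Torus (T : Fin 2 → ℝ) : Type := ∀ i, AddCircle (T i)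

/-- The point `P r` of the torus, `r : ℝ`. -/
def torusLine (T P : Fin 2 → ℝ) (r : ℝ) : Torus T := fun i => ((P i * r : ℝ) : AddCircle (T i))

/-- The reciprocal lattice vector `ξ = (2π n₁ / T₁, 2π n₂ / T₂)`. -/
def recip (T : Fin 2 → ℝ) (n : Fin 2 → ℤ) : Fin 2 → ℝ := fun i => 2 * Real.pi * n i / T i

/-- The Fourier mode `x ↦ exp (i ξ ⬝ x)` with `ξ = recip T n`. -/
def torusMode (T : Fin 2 → ℝ) (n : Fin 2 → ℤ) : C(Torus T, ℂ) where
  toFun x := ∏ i, fourier (n i) (x i)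
  continuous_toFun := by fun_prop

theorem torusMode_coe (T : Fin 2 → ℝ) (n : Fin 2 → ℤ) (x : Fin 2 → ℝ) :
    torusMode T n (fun i => (x i : AddCircle (T i))) =
      Complex.exp (Complex.I * ((∑ i, recip T n i * x i : ℝ) : ℂ)) := by
  simp only [torusMode, ContinuousMap.coe_mk, fourier_coe_apply, ← Complex.exp_sum, recip]
  congr 1
  push_cast
  rw [Finset.mul_sum]
  refine Finset.sum_congr rfl fun i _ => ?_
  ring

/-- The (first) Brillouin zone of the Bloch vector: the central cell of the reciprocal lattice. -/
def brillouinZone (T : Fin 2 → ℝ) : Set (Fin 2 → ℝ) :=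
  {k | ∀ i, k i ∈ Set.Icc (-(Real.pi / T i)) (Real.pi / T i)}

section TorusOps

variable (T : Fin 2 → ℝ) [∀ i, Fact (0 < T i)]

/-- `L²(𝒯²; ℂ)`. -/
abbrev TorusL2 : Type := Lp ℂ 2 (volume : Measure (Torus T))

/-- The (unnormalized) Fourier coefficient `∫ exp (-i ξ ⬝ x) U(x) dx`. -/
def torusCoeff (n : Fin 2 → ℤ) (U : TorusL2 T) : ℂ :=
  ∫ x, star (torusMode T n x) * U x

/-- The mode `exp (i ξ ⬝ x)` as an element of `L²(𝒯²)`. -/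
def torusModeLp (n : Fin 2 → ℤ) : TorusL2 T :=
  ContinuousMap.toLp (E := ℂ) 2 volume ℂ (torusMode T n)

theorem torusCoeff_eq_inner (n : Fin 2 → ℤ) (U : TorusL2 T) :
    torusCoeff T n U = inner ℂ (torusModeLp T n) U := by
  rw [L2.inner_def, torusCoeff]
  refine integral_congr_ae ?_
  filter_upwards [ContinuousMap.coeFn_toLp (p := 2) (𝕜 := ℂ) (volume : Measure (Torus T))
    (torusMode T n)] with x hx
  rw [torusModeLp, hx]
  simp [mul_comm]

/-- The graph of the Fourier multiplier with symbol `m` in `L²(𝒯²)`. -/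
def torusMultiplierGraph (m : (Fin 2 → ℤ) → ℂ) : Submodule ℂ (TorusL2 T × TorusL2 T) where
  carrier := {q | ∀ n, torusCoeff T n q.2 = m n * torusCoeff T n q.1}
  add_mem' := by
    intro a b ha hb n
    have ha := ha n
    have hb := hb n
    simp only [torusCoeff_eq_inner, Prod.fst_add, Prod.snd_add, inner_add_right] at *
    rw [ha, hb]; ring
  zero_mem' := by
    intro n
    simp [torusCoeff_eq_inner]
  smul_mem' := by
    intro c a ha n
    have ha := ha n
    simp only [torusCoeff_eq_inner, Prod.smul_fst, Prod.smul_snd, inner_smul_right] at *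
    rw [ha]; ring

theorem span_torusMode_dense :
    (Submodule.span ℂ (Set.range (torusMode T))).topologicalClosure = ⊤ := by
  let S : StarSubalgebra ℂ C(Torus T, ℂ) :=
    { toSubalgebra := Algebra.adjoin ℂ (Set.range (torusMode T))
      star_mem' := by
        change Algebra.adjoin ℂ (Set.range (torusMode T)) ≤
          star (Algebra.adjoin ℂ (Set.range (torusMode T)))
        refine Algebra.adjoin_le ?_
        rintro _ ⟨n, rfl⟩
        refine Algebra.subset_adjoin ⟨-n, ?_⟩
        ext1 x
        simp [torusMode, -fourier_apply, fourier_neg] }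
  have hS : S.toSubalgebra.toSubmodule = Submodule.span ℂ (Set.range (torusMode T)) := by
    apply Algebra.adjoin_eq_span_of_subset
    refine .trans (fun x ↦ Submonoid.closure_induction (fun _ ↦ id) ⟨0, ?_⟩ ?_)
      Submodule.subset_span
    · ext z
      simp [torusMode]
    · rintro _ _ _ _ ⟨m, rfl⟩ ⟨n, rfl⟩
      refine ⟨m + n, ?_⟩
      ext z
      simp only [torusMode, Pi.add_apply, fourier_add, Finset.prod_mul_distrib,
        ContinuousMap.coe_mk, ContinuousMap.mul_apply]
  have hsep : S.SeparatesPoints := by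
    intro x y hxy
    obtain ⟨i, hi⟩ := Function.ne_iff.mp hxy
    refine ⟨_, ⟨torusMode T (Pi.single i 1), Algebra.subset_adjoin ⟨_, rfl⟩, rfl⟩, ?_⟩
    have key : ∀ z : Torus T, torusMode T (Pi.single i 1) z = fourier 1 (z i) := by
      intro z
      simp only [torusMode, ContinuousMap.coe_mk]
      rw [Finset.prod_eq_single i]
      · simp
      · intro j _ hj
        rw [Pi.single_eq_of_ne hj, fourier_zero]
      · simp
    dsimp only
    rw [key, key, fourier_one, fourier_one]
    intro h
    exact hi (AddCircle.injective_toCircle (Fact.out (p := 0 < T i)).ne' (Circle.ext h))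
  rw [← hS]
  exact congr_arg (Subalgebra.toSubmodule <| StarSubalgebra.toSubalgebra ·)
    (ContinuousMap.starSubalgebra_topologicalClosure_eq_top_of_separatesPoints S hsep)

/-- A function in `L²(𝒯²)` is determined by its Fourier coefficients. -/
theorem eq_zero_of_torusCoeff (U : TorusL2 T) (h : ∀ n, torusCoeff T n U = 0) : U = 0 := by
  have hd : (Submodule.span ℂ (Set.range (torusModeLp T))).topologicalClosure = ⊤ := by
    simpa only [Submodule.map_span, ContinuousLinearMap.coe_coe, ← Set.range_comp,
      Function.comp_def] using!
      (ContinuousMap.toLp_denseRange ℂ (volume : Measure (Torus T)) ℂ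
        (by simp : (2 : ℝ≥0∞) ≠ ∞)).topologicalClosure_map_submodule (span_torusMode_dense T)
  have hU : U ∈ (Submodule.span ℂ (Set.range (torusModeLp T)))ᗮ := by
    rw [Submodule.mem_orthogonal]
    intro v hv
    induction hv using Submodule.span_induction with
    | mem v hv =>
      obtain ⟨n, rfl⟩ := hv
      rw [← torusCoeff_eq_inner, h n]
    | zero => simp
    | add v w _ _ hv hw => rw [inner_add_left, hv, hw, add_zero]
    | smul c v _ hv => rw [inner_smul_left, hv, mul_zero]
  rw [← Submodule.orthogonal_closure, hd, Submodule.top_orthogonal_eq_bot] at hU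
  simpa using hU

theorem torusMultiplierGraph_unique (m : (Fin 2 → ℤ) → ℂ) (q : TorusL2 T × TorusL2 T)
    (hq : q ∈ torusMultiplierGraph T m) (h0 : q.1 = 0) : q.2 = 0 := by
  refine eq_zero_of_torusCoeff T _ fun n => ?_
  have h : torusCoeff T n q.2 = m n * torusCoeff T n q.1 := hq n
  rw [h, h0, torusCoeff_eq_inner, inner_zero_right, mul_zero]

/-- The Fourier multiplier with symbol `m`, `U = ∑ U_ξ exp (i ξ ⬝ x) ↦ ∑ m(ξ) U_ξ exp (i ξ ⬝ x)`,
on its natural (maximal) domain in `L²(𝒯²)`. -/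
def torusMultiplier (m : (Fin 2 → ℤ) → ℂ) : TorusL2 T →ₗ.[ℂ] TorusL2 T :=
  (torusMultiplierGraph T m).toLinearPMap

theorem torusMultiplier_graph (m : (Fin 2 → ℤ) → ℂ) :
    (torusMultiplier T m).graph = torusMultiplierGraph T m :=
  Submodule.toLinearPMap_graph_eq _ (torusMultiplierGraph_unique T m)

/-- The symbol of `∇_P + i Pᵀ k`, `∇_P = P₁ ∂₁ + P₂ ∂₂`, on the mode `exp (i ξ ⬝ x)`:
`i Pᵀ ξ + i Pᵀ k`. -/
def blochSymbol (P k : Fin 2 → ℝ) (n : Fin 2 → ℤ) : ℂ :=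
  Complex.I * ((∑ i, P i * recip T n i : ℝ) : ℂ) + Complex.I * ((∑ i, P i * k i : ℝ) : ℂ)

/-- The lifted operator `(∇_P + i Pᵀ k)²` on `L²(𝒯²)`. -/
def liftedLaplacian (P k : Fin 2 → ℝ) : TorusL2 T →ₗ.[ℂ] TorusL2 T :=
  torusMultiplier T fun n => blochSymbol T P k n ^ 2

end TorusOps

end

/-! Take `z` outside the closure on the right; the task is to invert the line pencil `d²/dr² - z ε`.
Since `d²/dr²` is essentially self-adjoint on Schwartz functions, it suffices to bound the pencils
at `z` and at its conjugate from below on Schwartz functions (`mem_pairResolventSet_line`).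
Compactness gives `E ≥ m > 0`, so for nonreal `z` pairing with the function itself and taking
imaginary parts yields the bound `|Im z| m`.

For real `z`, a ball of radius `δ` about `z` misses every lifted spectrum. Symmetrising the lifted
pencil by the square root of `E` turns this into the lower bound `δ m`, the same for all Bloch
vectors `k` (`norm_le_of_ball_subset_torus`).

This bound is transferred to the line (`line_bound_of_torus_bound`). Restricting an L² function on
the torus to a line makes no sense, so one works in the other direction. A Schwartz function `u` is
spread along the line by the lift `u(r) φ(x - P r)` and Fourier transformed in `r`. For each
frequency `w`, write `2πw = Pᵀ(k + ξ)` with `k` in the Brillouin zone and `ξ` a reciprocal lattice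
vector. Modulated by the mode of `ξ`, the lift lies in the domain of the operator at `k`, which
sends it to the lift of `u''`. Integrating the squared torus bounds over `w` and applying Plancherel
gives the desired line inequality, averaged over the translates `E(y + P r)` with weight `|φ(y)|²`.
Concentrating `φ` near `0` replaces `E(y + P r)` by `ε(r)` up to a uniformly small error, by uniform
continuity of `E`. -/

noncomputable section

/-! ### Abstract symmetric pencils: invertibility and lower bounds. -/

section AbstractPencil

variable {H : Type*} [NormedAddCommGroup H] [InnerProductSpace ℂ H]

open scoped InnerProductSpace

/-- Resolvent criterion for a pencil `A - z B` in terms of a core `S` of `A`, when `A` is the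
adjoint of its restriction to the core. -/
theorem mem_pairResolventSet_of_core [CompleteSpace H] (A : H →ₗ.[ℂ] H) (B : H →L[ℂ] H)
    (hB : ∀ x y, ⟪B x, y⟫_ℂ = ⟪x, B y⟫_ℂ) (S : Submodule ℂ (H × H))
    (hSA : S ≤ A.graph) (hAS : A.graph ≤ S.topologicalClosure)
    (hsymm : ∀ p ∈ S, ∀ q ∈ S, ⟪p.1, q.2⟫_ℂ = ⟪p.2, q.1⟫_ℂ)
    (hadj : ∀ q : H × H, (∀ p ∈ S, ⟪q.1, p.2⟫_ℂ = ⟪q.2, p.1⟫_ℂ) → q ∈ A.graph)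
    {z : ℂ} {c : ℝ} (hc : 0 < c)
    (hz : ∀ p ∈ S, c * ‖p.1‖ ≤ ‖p.2 - z • B p.1‖)
    (hz' : ∀ p ∈ S, c * ‖p.1‖ ≤ ‖p.2 - star z • B p.1‖) :
    z ∈ pairResolventSet A B := by
  have ext_bound : ∀ z : ℂ, (∀ p ∈ S, c * ‖p.1‖ ≤ ‖p.2 - z • B p.1‖) →
      ∀ p ∈ A.graph, c * ‖p.1‖ ≤ ‖p.2 - z • B p.1‖ := by
    intro z hz p hp
    have hcl : IsClosed {p : H × H | c * ‖p.1‖ ≤ ‖p.2 - z • B p.1‖} :=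
      isClosed_le (by fun_prop) (by fun_prop)
    exact hcl.closure_subset_iff.2 hz (hAS hp)
  have hmem : ∀ q : H × H, q ∈ A.graph → ∀ p ∈ S, ⟪q.1, p.2⟫_ℂ = ⟪q.2, p.1⟫_ℂ := by
    intro q hq p hp
    have hcl : IsClosed {q : H × H | ⟪q.1, p.2⟫_ℂ = ⟪q.2, p.1⟫_ℂ} :=
      isClosed_eq (by fun_prop) (by fun_prop)
    exact hcl.closure_subset_iff.2 (fun q hq => hsymm q hq p hp) (hAS hq)
  -- The graph is that of the adjoint of the core, cut out by closed conditions, hence complete; the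
  -- pencil can be studied as a bounded map on it.
  have hclosed : IsClosed (A.graph : Set (H × H)) := by
    have : (A.graph : Set (H × H)) =
        ⋂ p ∈ S, {q : H × H | ⟪q.1, p.2⟫_ℂ = ⟪q.2, p.1⟫_ℂ} := by
      ext q
      simp only [SetLike.mem_coe, Set.mem_iInter, Set.mem_ofPred_eq]
      exact ⟨hmem q, hadj q⟩
    rw [this]
    exact isClosed_biInter fun p _ => isClosed_eq (by fun_prop) (by fun_prop)
  have : CompleteSpace A.graph := hclosed.completeSpace_coe
  let L : A.graph →L[ℂ] H :=
    (ContinuousLinearMap.snd ℂ H H - z • B.comp (ContinuousLinearMap.fst ℂ H H)).comp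
      A.graph.subtypeL
  have hL : ∀ q : A.graph, L q = (q : H × H).2 - z • B (q : H × H).1 := fun q => rfl
  have hb1 : ∀ q : A.graph, c * ‖(q : H × H).1‖ ≤ ‖L q‖ := fun q => ext_bound z hz q q.2
  -- The pencil equation controls the second component by the first, so the lower bound upgrades to
  -- the graph norm. Injectivity and closed range follow.
  have hanti : ∀ q : A.graph, ‖q‖ ≤ (c⁻¹ + (1 + ‖z‖ * ‖B‖ * c⁻¹)) * ‖L q‖ := by
    intro q
    have h1 : ‖(q : H × H).1‖ ≤ c⁻¹ * ‖L q‖ := by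
      rw [inv_mul_eq_div, le_div_iff₀ hc, mul_comm]; exact hb1 q
    have h2 : ‖(q : H × H).2‖ ≤ (1 + ‖z‖ * ‖B‖ * c⁻¹) * ‖L q‖ := by
      have : (q : H × H).2 = L q + z • B (q : H × H).1 := by rw [hL]; abel
      rw [this]
      calc _ ≤ ‖L q‖ + ‖z • B (q : H × H).1‖ := norm_add_le _ _
        _ ≤ ‖L q‖ + ‖z‖ * (‖B‖ * (c⁻¹ * ‖L q‖)) := by
          rw [norm_smul]
          gcongr
          exact (B.le_opNorm _).trans (by gcongr)
        _ = _ := by ring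
    have h3 : 0 ≤ c⁻¹ * ‖L q‖ := by positivity
    have h4 : 0 ≤ (1 + ‖z‖ * ‖B‖ * c⁻¹) * ‖L q‖ := by positivity
    change ‖(q : H × H)‖ ≤ _
    rw [Prod.norm_def, add_mul]
    exact max_le (by linarith) (by linarith)
  have hantiL : AntilipschitzWith ⟨c⁻¹ + (1 + ‖z‖ * ‖B‖ * c⁻¹), by positivity⟩ L :=
    AddMonoidHomClass.antilipschitz_of_bound L hanti
  have hker : L.ker = ⊥ := LinearMap.ker_eq_bot.2 hantiL.injective
  have hrange : L.range = ⊤ := by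
    have hrc : IsClosed (L.range : Set H) := by
      have := hantiL.isClosed_range L.uniformContinuous
      rwa [← ContinuousLinearMap.coe_coe, ← LinearMap.coe_range] at this
    have : CompleteSpace L.range := hrc.completeSpace_coe
    rw [← Submodule.orthogonal_eq_bot_iff, Submodule.eq_bot_iff]
    intro y hy
    -- A vector orthogonal to the range solves the adjoint equation weakly, so it lies in the kernel
    -- of the pencil at the conjugate point, which `hz'` makes trivial.
    have hy' : (y, star z • B y) ∈ A.graph := by
      refine hadj _ fun p hp => ?_
      have h0 : ⟪L ⟨p, hSA hp⟩, y⟫_ℂ = 0 :=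
        (Submodule.mem_orthogonal _ _).1 hy _ ⟨_, rfl⟩
      rw [← inner_conj_symm, map_eq_zero, hL, inner_sub_right, inner_smul_right, sub_eq_zero] at h0
      simp only [inner_smul_left, hB, h0]
      simp
    have := ext_bound (star z) hz' _ hy'
    simp only [sub_self, norm_zero] at this
    exact norm_le_zero_iff.1 (nonpos_of_mul_nonpos_right this hc)
  let e := ContinuousLinearEquiv.ofBijective L hker hrange
  refine ⟨((ContinuousLinearMap.fst ℂ H H).comp A.graph.subtypeL).comp
    (e.symm : H →L[ℂ] A.graph), fun f => ?_, fun u => ?_⟩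
  · have hq := (e.symm f).2
    obtain ⟨v, hv1, hv2⟩ := (LinearPMap.mem_graph_iff A).1 hq
    have hLf : L (e.symm f) = f := e.apply_symm_apply f
    rw [hL, ← hv1, ← hv2] at hLf
    have hdom : ((e.symm f : A.graph) : H × H).1 ∈ A.domain := hv1 ▸ v.2
    have hv : v = ⟨((e.symm f : A.graph) : H × H).1, hdom⟩ := Subtype.ext hv1
    refine ⟨hdom, ?_⟩
    rw [hv] at hLf
    exact hLf
  · have : (e.symm (A u - z • B u)) = ⟨(u, A u), A.mem_graph u⟩ := by
      rw [ContinuousLinearEquiv.symm_apply_eq]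
      rfl
    change ((e.symm (A u - z • B u) : A.graph) : H × H).1 = u
    rw [this]

/-- For a symmetric `A` and a positive `B = Q²`, the distance of a real `z` to the spectrum
of the pencil gives a lower bound for `A - z B`. -/
theorem norm_le_of_ball_subset_pairResolventSet [CompleteSpace H]
    (A : H →ₗ.[ℂ] H) (Q Q' : H →L[ℂ] H)
    (hQ : IsSelfAdjoint Q) (hQQ' : Q * Q' = 1) (hQ'Q : Q' * Q = 1)
    (hsymm : ∀ u v : A.domain, ⟪(u : H), A v⟫_ℂ = ⟪A u, (v : H)⟫_ℂ)
    {z : ℂ} (hzr : star z = z) {δ : ℝ} (hδ : 0 < δ)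
    (hball : Metric.ball z δ ⊆ pairResolventSet A (Q * Q)) (u : A.domain) :
    ‖(u : H)‖ ≤ δ⁻¹ * ‖Q'‖ ^ 2 * ‖A u - z • (Q * Q) u‖ := by
  have mul_app : ∀ (S S' : H →L[ℂ] H) (x : H), (S * S') x = S (S' x) := fun _ _ _ => rfl
  have hBs : ∀ x y, ⟪(Q * Q) x, y⟫_ℂ = ⟪x, (Q * Q) y⟫_ℂ := fun x y => by
    simp only [mul_app]
    rw [hQ.isSymmetric.apply_clm, hQ.isSymmetric.apply_clm]
  -- The resolvent identity for pencils; it uses only a right inverse at `w₁` and a left inverse at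
  -- `w₂`.
  have key : ∀ w₁ w₂ : ℂ, ∀ R₁ R₂ : H →L[ℂ] H,
      (∀ f : H, ∃ h : R₁ f ∈ A.domain, A ⟨R₁ f, h⟩ - w₁ • (Q * Q) (R₁ f) = f) →
      (∀ u : A.domain, R₂ (A u - w₂ • (Q * Q) u) = u) →
      R₁ = R₂ + (w₁ - w₂) • (R₂ * (Q * Q) * R₁) := by
    intro w₁ w₂ R₁ R₂ h₁ h₂
    ext f
    obtain ⟨h, hf⟩ := h₁ f
    have h3 := h₂ ⟨R₁ f, h⟩
    have h4 : A ⟨R₁ f, h⟩ - w₂ • (Q * Q) (R₁ f) = f + (w₁ - w₂) • (Q * Q) (R₁ f) := by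
      rw [sub_smul]; nth_rw 3 [← hf]; abel
    simp only [h4, map_add, map_smul] at h3
    simpa using h3.symm
  obtain ⟨R, hR1, hR2⟩ := hball (Metric.mem_ball_self hδ)
  -- Formally `K` is the resolvent at `z` of `Q⁻¹ A Q⁻¹`. It is self-adjoint because `z` is real, so
  -- its norm equals its spectral radius.
  set K := Q * R * Q with hK
  have hRs : ∀ f g, ⟪R f, g⟫_ℂ = ⟪f, R g⟫_ℂ := by
    intro f g
    obtain ⟨hf, hf'⟩ := hR1 f
    obtain ⟨hg, hg'⟩ := hR1 g
    have h1 := hsymm ⟨R f, hf⟩ ⟨R g, hg⟩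
    calc ⟪R f, g⟫_ℂ = ⟪R f, A ⟨R g, hg⟩ - z • (Q * Q) (R g)⟫_ℂ := by rw [hg']
      _ = ⟪A ⟨R f, hf⟩ - z • (Q * Q) (R f), R g⟫_ℂ := by
        rw [inner_sub_right, inner_sub_left, h1, inner_smul_right, inner_smul_left, hBs,
          starRingEnd_apply, hzr]
      _ = _ := by rw [hf']
  have hKs : IsSelfAdjoint K := by
    rw [ContinuousLinearMap.isSelfAdjoint_iff_isSymmetric]
    intro x y
    simp only [hK, ContinuousLinearMap.coe_coe, mul_app]
    rw [hQ.isSymmetric.apply_clm, hRs, hQ.isSymmetric.apply_clm]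
  have hKnorm : ‖K‖ ≤ δ⁻¹ := by
    have hspec : ∀ l ∈ spectrum ℂ K, ‖l‖ ≤ δ⁻¹ := by
      intro l hl
      by_contra! hlt
      have hl0 : 0 < ‖l‖ := lt_trans (by positivity) hlt
      have hl0' : l ≠ 0 := norm_pos_iff.1 hl0
      apply hl
      -- A spectral value `l` of `K` would correspond to the spectral point `z + l⁻¹` of the pencil.
      -- With `K'` the symmetrised resolvent there, the resolvent identities give `(l - K)(l + K') =
      -- l²`, so `l - K` is invertible.
      have hw : z + l⁻¹ ∈ Metric.ball z δ := by
        rw [Metric.mem_ball, dist_eq_norm, add_sub_cancel_left, norm_inv]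
        exact inv_lt_of_inv_lt₀ hδ hlt
      obtain ⟨R', hR1', hR2'⟩ := hball hw
      have e1 := key z (z + l⁻¹) R R' hR1 hR2'
      have e2 := key (z + l⁻¹) z R' R hR1' hR2
      set K' := Q * R' * Q with hK'
      have f1 : K = K' - l⁻¹ • (K' * K) := by
        rw [hK, hK']; nth_rw 1 [e1]
        rw [show z - (z + l⁻¹) = -l⁻¹ by ring]
        simp only [mul_add, add_mul, mul_smul_comm, smul_mul_assoc, mul_assoc, neg_smul, mul_neg,
          neg_mul, sub_eq_add_neg]
      have f2 : K' = K + l⁻¹ • (K * K') := by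
        rw [hK, hK']; nth_rw 1 [e2]
        simp only [mul_add, add_mul, mul_smul_comm, smul_mul_assoc, mul_assoc, add_sub_cancel_left]
      have g1 : l • K = l • K' - K' * K := by
        nth_rw 1 [f1]; rw [smul_sub, smul_smul, mul_inv_cancel₀ hl0', one_smul]
      have g2 : l • K' = l • K + K * K' := by
        nth_rw 1 [f2]; rw [smul_add, smul_smul, mul_inv_cancel₀ hl0', one_smul]
      have hcomm : K' * K = K * K' := by
        have := g1
        rw [g2] at this
        have h5 : K * K' - K' * K = 0 := by
          have h6 := sub_eq_zero.2 this
          have : l • K + K * K' - K' * K - l • K = K * K' - K' * K := by abel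
          rw [← this, ← neg_sub, h6, neg_zero]
        exact (sub_eq_zero.1 h5).symm
      have hprod : (algebraMap ℂ (H →L[ℂ] H) l - K) * (algebraMap ℂ _ l + K') =
          algebraMap ℂ _ (l * l) := by
        simp only [Algebra.algebraMap_eq_smul_one, sub_mul, mul_add, smul_mul_assoc, one_mul,
          mul_smul_comm, mul_one]
        rw [g2, smul_sub, smul_smul]
        abel
      have hprod' : (algebraMap ℂ (H →L[ℂ] H) l + K') * (algebraMap ℂ _ l - K) =
          algebraMap ℂ _ (l * l) := by
        rw [← hprod]
        have hc : Commute (algebraMap ℂ (H →L[ℂ] H) l) K := Algebra.commutes l K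
        have hc' : Commute (algebraMap ℂ (H →L[ℂ] H) l) K' := Algebra.commutes l K'
        simp only [mul_sub, add_mul, sub_mul, mul_add, hcomm, hc.eq, hc'.eq]
        abel
      have hu : IsUnit (algebraMap ℂ (H →L[ℂ] H) (l * l)) :=
        (IsUnit.mk0 _ (mul_ne_zero hl0' hl0')).map _
      have := (hprod.symm ▸ hu : IsUnit ((algebraMap ℂ (H →L[ℂ] H) l - K) * (algebraMap ℂ _ l + K')))
      exact (Commute.isUnit_mul_iff (hprod.trans hprod'.symm)).1 this |>.1
    have h1 := hKs.spectralRadius_eq_nnnorm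
    have h2 : spectralRadius ℂ K ≤ ENNReal.ofReal δ⁻¹ := by
      refine iSup₂_le fun l hl => ?_
      rw [← enorm_eq_nnnorm, ← ofReal_norm]
      exact ENNReal.ofReal_le_ofReal (hspec l hl)
    rw [h1, ← enorm_eq_nnnorm, ← ofReal_norm] at h2
    exact (ENNReal.ofReal_le_ofReal_iff (by positivity)).1 h2
  set f := A u - z • (Q * Q) u with hf
  have hu : (u : H) = R f := (hR2 u).symm
  have h1 : Q u = K (Q' f) := by
    have : Q (Q' f) = f := by rw [← mul_app, hQQ']; rfl
    rw [hK, mul_app, mul_app]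
    rw [this, ← hu]
  have h2 : (u : H) = Q' (Q u) := by rw [← mul_app, hQ'Q]; rfl
  calc ‖(u : H)‖ = ‖Q' (K (Q' f))‖ := by rw [← h1, ← h2]
    _ ≤ ‖Q'‖ * (‖K‖ * (‖Q'‖ * ‖f‖)) := by
      refine (Q'.le_opNorm _).trans ?_
      gcongr
      refine (K.le_opNorm _).trans ?_
      gcongr
      exact Q'.le_opNorm _
    _ ≤ ‖Q'‖ * (δ⁻¹ * (‖Q'‖ * ‖f‖)) := by gcongr
    _ = _ := by ring

/-- Lower bound for a symmetric pencil with `B ≥ m > 0` at a nonreal point. -/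
theorem abs_im_mul_norm_le {B : H →L[ℂ] H} {m : ℝ}
    (hB : ∀ x, m * ‖x‖ ^ 2 ≤ (⟪x, B x⟫_ℂ).re) (hBs : ∀ x y, ⟪B x, y⟫_ℂ = ⟪x, B y⟫_ℂ)
    {x y : H} (hxy : ⟪x, y⟫_ℂ = ⟪y, x⟫_ℂ) (z : ℂ) :
    |z.im| * m * ‖x‖ ≤ ‖y - z • B x‖ := by
  rcases eq_or_ne x 0 with rfl | hx
  · simp
  have h1 : (⟪x, y⟫_ℂ).im = 0 := by
    rw [← Complex.conj_eq_iff_im, inner_conj_symm, hxy]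
  have h2 : (⟪x, B x⟫_ℂ).im = 0 := by
    rw [← Complex.conj_eq_iff_im, inner_conj_symm, hBs]
  -- Both `⟪x, y⟫` and `⟪x, B x⟫` are real, so only `Im z` survives.
  have h3 : (⟪x, y - z • B x⟫_ℂ).im = -(z.im * (⟪x, B x⟫_ℂ).re) := by
    rw [inner_sub_right, inner_smul_right]
    simp [h1, h2]
  have h4 : |z.im| * (m * ‖x‖ ^ 2) ≤ ‖x‖ * ‖y - z • B x‖ := by
    calc _ ≤ |z.im| * |(⟪x, B x⟫_ℂ).re| := by
          gcongr; exact (hB x).trans (le_abs_self _)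
      _ = |(⟪x, y - z • B x⟫_ℂ).im| := by rw [h3, abs_neg, abs_mul]
      _ ≤ ‖⟪x, y - z • B x⟫_ℂ‖ := Complex.abs_im_le_norm _
      _ ≤ _ := norm_inner_le_norm _ _
  have hx' : 0 < ‖x‖ := norm_pos_iff.2 hx
  refine le_of_mul_le_mul_left ?_ hx'
  linarith [h4]

end AbstractPencil

/-! ### Multiplication operators: symmetry, products and positivity. -/

section MulOp

open scoped InnerProductSpace

variable {X : Type*} [TopologicalSpace X] [MeasurableSpace X] [OpensMeasurableSpace X]
  (μ : Measure X)

theorem mulOp_inner (g : X →ᵇ ℝ) (u v : Lp ℂ 2 μ) :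
    ⟪mulOp μ g u, v⟫_ℂ = ⟪u, mulOp μ g v⟫_ℂ := by
  rw [L2.inner_def, L2.inner_def]
  refine integral_congr_ae ?_
  filter_upwards [mulOp_ae μ g u, mulOp_ae μ g v] with x h1 h2
  rw [h1, h2]
  simp
  ring

theorem mulOp_isSelfAdjoint (g : X →ᵇ ℝ) : IsSelfAdjoint (mulOp μ g) := by
  rw [ContinuousLinearMap.isSelfAdjoint_iff_isSymmetric]
  exact fun u v => mulOp_inner μ g u v

theorem mulOp_mul (g h : X →ᵇ ℝ) : mulOp μ g * mulOp μ h = mulOp μ (g * h) := by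
  ext1 u
  refine Lp.ext ?_
  change mulOp μ g (mulOp μ h u) =ᵐ[μ] _
  filter_upwards [mulOp_ae μ g (mulOp μ h u), mulOp_ae μ h u, mulOp_ae μ (g * h) u]
    with x h1 h2 h3
  rw [h1, h2, h3]
  simp [mul_assoc]

theorem mulOp_one : mulOp μ (1 : X →ᵇ ℝ) = 1 := by
  ext1 u
  refine Lp.ext ?_
  filter_upwards [mulOp_ae μ 1 u] with x h1
  rw [h1]
  simp

theorem le_re_inner_mulOp {g : X →ᵇ ℝ} {m : ℝ} (hm : ∀ x, m ≤ g x) (u : Lp ℂ 2 μ) :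
    m * ‖u‖ ^ 2 ≤ (⟪u, mulOp μ g u⟫_ℂ).re := by
  have h1 : ‖u‖ ^ 2 = (⟪u, u⟫_ℂ).re := (inner_self_eq_norm_sq (𝕜 := ℂ) u).symm
  have h2 : Integrable (fun x => ⟪u x, mulOp μ g u x⟫_ℂ) μ := L2.integrable_inner _ _
  have h3 : Integrable (fun x => ⟪u x, u x⟫_ℂ) μ := L2.integrable_inner _ _
  rw [h1, L2.inner_def, L2.inner_def]
  have e2 := integral_re (𝕜 := ℂ) h2
  have e3 := integral_re (𝕜 := ℂ) h3
  simp only [RCLike.re_eq_complex_re] at e2 e3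
  rw [← e2, ← e3, ← integral_const_mul]
  refine integral_mono_ae ?_ ?_ ?_
  · exact (Integrable.re h3).const_mul m
  · exact Integrable.re h2
  · filter_upwards [mulOp_ae μ g u] with x hx
    simp only [hx]
    have : ⟪u x, (g x : ℂ) * u x⟫_ℂ = ((g x * ‖u x‖ ^ 2 : ℝ) : ℂ) := by
      rw [← smul_eq_mul, inner_smul_right, inner_self_eq_norm_sq_to_K]
      push_cast; rfl
    have h' : ⟪u x, u x⟫_ℂ = ((‖u x‖ ^ 2 : ℝ) : ℂ) := by
      rw [inner_self_eq_norm_sq_to_K]; push_cast; rfl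
    rw [this, h', Complex.ofReal_re, Complex.ofReal_re]
    gcongr
    exact hm x

end MulOp

/-! ### Essential self-adjointness of the second derivative on Schwartz functions. -/

section Line

open scoped InnerProductSpace FourierTransform ContDiff

/-- Second derivative on Schwartz functions. -/
def schwartzDeriv2 : 𝓢(ℝ, ℂ) →L[ℂ] 𝓢(ℝ, ℂ) :=
  (SchwartzMap.derivCLM ℂ ℂ).comp (SchwartzMap.derivCLM ℂ ℂ)

/-- The graph of the second derivative restricted to Schwartz functions. -/
def schwartzGraph : Submodule ℂ (LineL2 × LineL2) :=
  LinearMap.range ((toLpCLM ℂ ℂ 2 (volume : Measure ℝ)).prod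
    ((toLpCLM ℂ ℂ 2 (volume : Measure ℝ)).comp schwartzDeriv2) :
      𝓢(ℝ, ℂ) →L[ℂ] LineL2 × LineL2).toLinearMap

theorem mem_schwartzGraph (φ : 𝓢(ℝ, ℂ)) :
    (φ.toLp 2 volume, (schwartzDeriv2 φ).toLp 2 volume) ∈ schwartzGraph := ⟨φ, rfl⟩

theorem exists_of_mem_schwartzGraph {p : LineL2 × LineL2} (hp : p ∈ schwartzGraph) :
    ∃ φ : 𝓢(ℝ, ℂ), p = (φ.toLp 2 volume, (schwartzDeriv2 φ).toLp 2 volume) := by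
  obtain ⟨φ, rfl⟩ := hp
  exact ⟨φ, rfl⟩

/-- Complex conjugation of Schwartz functions. -/
def schwartzConj (φ : 𝓢(ℝ, ℂ)) : 𝓢(ℝ, ℂ) :=
  φ.postcompCLM (Complex.conjCLE : ℂ →L[ℝ] ℂ)

theorem schwartzConj_apply (φ : 𝓢(ℝ, ℂ)) (x : ℝ) : schwartzConj φ x = star (φ x) := rfl

theorem schwartzConj_conj (φ : 𝓢(ℝ, ℂ)) : schwartzConj (schwartzConj φ) = φ := by
  ext x
  simp [schwartzConj_apply]

theorem derivCLM_schwartzConj (φ : 𝓢(ℝ, ℂ)) :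
    SchwartzMap.derivCLM ℂ ℂ (schwartzConj φ) = schwartzConj (SchwartzMap.derivCLM ℂ ℂ φ) := by
  ext x
  exact (φ.hasDerivAt x).star.deriv

theorem schwartzDeriv2_conj (φ : 𝓢(ℝ, ℂ)) :
    schwartzDeriv2 (schwartzConj φ) = schwartzConj (schwartzDeriv2 φ) := by
  simp [schwartzDeriv2, derivCLM_schwartzConj]

theorem inner_toLp_eq_integral (u : LineL2) (φ : 𝓢(ℝ, ℂ)) :
    ⟪u, φ.toLp 2 volume⟫_ℂ = star (∫ x, schwartzConj φ x • u x) := by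
  rw [L2.inner_def, ← starRingEnd_apply, ← integral_conj]
  refine integral_congr_ae ?_
  filter_upwards [φ.coeFn_toLp 2 volume] with x hx
  rw [hx]
  simp [schwartzConj_apply]

/-- Distributional testing is bilinear while the inner product is sesquilinear; conjugating the test
function, which commutes with differentiation, reconciles them. Thus `d²/dr²` is the adjoint of its
Schwartz restriction. -/
theorem mem_lineLaplacianGraph_iff (q : LineL2 × LineL2) :
    q ∈ lineLaplacianGraph ↔ ∀ φ : 𝓢(ℝ, ℂ),
      ⟪q.1, (schwartzDeriv2 φ).toLp 2 volume⟫_ℂ = ⟪q.2, φ.toLp 2 volume⟫_ℂ := by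
  have h1 : q ∈ lineLaplacianGraph ↔ ∀ φ : 𝓢(ℝ, ℂ),
      ∫ x, schwartzDeriv2 φ x • q.1 x = ∫ x, φ x • q.2 x := by
    change TemperedDistribution.derivCLM ℂ (TemperedDistribution.derivCLM ℂ
      (Lp.toTemperedDistributionCLM ℂ volume 2 q.1)) =
      Lp.toTemperedDistributionCLM ℂ volume 2 q.2 ↔ _
    constructor
    · intro h φ
      have := DFunLike.congr_fun h φ
      simp only [TemperedDistribution.derivCLM_apply_apply, map_neg, neg_neg,
        Lp.toTemperedDistributionCLM_apply, Lp.toTemperedDistribution_apply] at this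
      exact this
    · intro h
      ext φ
      simp only [TemperedDistribution.derivCLM_apply_apply, map_neg, neg_neg,
        Lp.toTemperedDistributionCLM_apply, Lp.toTemperedDistribution_apply]
      exact h φ
  rw [h1]
  constructor
  · intro h φ
    rw [inner_toLp_eq_integral, inner_toLp_eq_integral, ← schwartzDeriv2_conj, h]
  · intro h φ
    have := h (schwartzConj φ)
    rw [inner_toLp_eq_integral, inner_toLp_eq_integral, ← schwartzDeriv2_conj, schwartzConj_conj]
      at this
    exact star_injective this

theorem schwartzGraph_le : schwartzGraph ≤ lineLaplacianGraph := by
  intro p hp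
  obtain ⟨φ, rfl⟩ := exists_of_mem_schwartzGraph hp
  change TemperedDistribution.derivCLM ℂ (TemperedDistribution.derivCLM ℂ
      (Lp.toTemperedDistributionCLM ℂ volume 2 (φ.toLp 2 volume))) =
      Lp.toTemperedDistributionCLM ℂ volume 2 ((schwartzDeriv2 φ).toLp 2 volume)
  rw [Lp.toTemperedDistributionCLM_apply, Lp.toTemperedDistributionCLM_apply,
    Lp.toTemperedDistribution_toLp_eq, Lp.toTemperedDistribution_toLp_eq,
    TemperedDistribution.derivCLM_toTemperedDistributionCLM_eq ℂ,
    TemperedDistribution.derivCLM_toTemperedDistributionCLM_eq ℂ]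
  rfl

theorem fourier_schwartzDeriv2 (φ : 𝓢(ℝ, ℂ)) (w : ℝ) :
    𝓕 (schwartzDeriv2 φ : ℝ → ℂ) w = (2 * Real.pi * Complex.I * w) ^ 2 * 𝓕 (φ : ℝ → ℂ) w := by
  have h1 : (schwartzDeriv2 φ : ℝ → ℂ) = deriv (SchwartzMap.derivCLM ℂ ℂ φ) := rfl
  have h2 : (SchwartzMap.derivCLM ℂ ℂ φ : ℝ → ℂ) = deriv φ := rfl
  rw [h1, Real.fourier_deriv (SchwartzMap.integrable _) (SchwartzMap.differentiable _)
    (SchwartzMap.derivCLM ℂ ℂ (SchwartzMap.derivCLM ℂ ℂ φ)).integrable, h2,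
    Real.fourier_deriv φ.integrable φ.differentiable (SchwartzMap.derivCLM ℂ ℂ φ).integrable]
  simp only [smul_eq_mul]
  ring

/-- The symbol `1 / (1 + w²)`. -/
def resolventSymbol : ℝ →ᵇ ℝ :=
  BoundedContinuousFunction.ofNormedAddCommGroup (fun w => (1 + w ^ 2)⁻¹)
    (Continuous.inv₀ (by fun_prop) fun w => by positivity) 1 fun w => by
      rw [Real.norm_of_nonneg (by positivity)]
      exact inv_le_one_of_one_le₀ (by nlinarith [sq_nonneg w])

/-- Needed so that multiplication by the symbol, and hence the resolvent, preserves Schwartz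
functions. -/
theorem resolventSymbol_hasTemperateGrowth :
    Function.HasTemperateGrowth (fun w : ℝ => ((resolventSymbol w : ℝ) : ℂ)) := by
  have h : (fun w : ℝ => ((resolventSymbol w : ℝ) : ℂ)) =
      fun w : ℝ => (((1 + ‖w‖ ^ 2) ^ (-1 : ℝ) : ℝ) : ℂ) := by
    ext w
    rw [Real.rpow_neg_one, Real.norm_eq_abs, sq_abs]
    rfl
  rw [h]
  fun_prop

/-- The resolvent `(1 - (2π)⁻² d²/dr²)⁻¹` on `L²`. -/
def lineResolvent (g : LineL2) : LineL2 :=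
  𝓕⁻ (mulOp volume resolventSymbol (𝓕 g))

/-- The resolvent `(1 - (2π)⁻² d²/dr²)⁻¹` on Schwartz functions. -/
def schwartzResolvent (φ : 𝓢(ℝ, ℂ)) : 𝓢(ℝ, ℂ) :=
  𝓕⁻ (smulLeftCLM ℂ (fun w : ℝ => ((resolventSymbol w : ℝ) : ℂ)) (𝓕 φ))

theorem lineResolvent_toLp (φ : 𝓢(ℝ, ℂ)) :
    lineResolvent (φ.toLp 2 volume) = (schwartzResolvent φ).toLp 2 volume := by
  rw [lineResolvent, schwartzResolvent, SchwartzMap.toLp_fourier_eq,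
    ← SchwartzMap.toLp_fourierInv_eq]
  congr 1
  refine Lp.ext ?_
  filter_upwards [mulOp_ae volume resolventSymbol ((𝓕 φ).toLp 2 volume),
    (𝓕 φ).coeFn_toLp 2 volume, (smulLeftCLM ℂ (fun w : ℝ => ((resolventSymbol w : ℝ) : ℂ))
      (𝓕 φ)).coeFn_toLp 2 volume] with x h1 h2 h3
  rw [h1, h2, h3, smulLeftCLM_apply_apply resolventSymbol_hasTemperateGrowth, smul_eq_mul]

theorem schwartzResolvent_spec (φ : 𝓢(ℝ, ℂ)) :
    schwartzResolvent φ - (((2 * Real.pi) ^ 2)⁻¹ : ℂ) • schwartzDeriv2 (schwartzResolvent φ) =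
      φ := by
  have hinj : Function.Injective (fun f : 𝓢(ℝ, ℂ) => 𝓕 f) := fun f g h => by
    have h' : (𝓕 f : 𝓢(ℝ, ℂ)) = 𝓕 g := h
    have := congrArg (fun f : 𝓢(ℝ, ℂ) => (𝓕⁻ f : 𝓢(ℝ, ℂ))) h'
    simpa only [FourierTransform.fourierInv_fourier_eq] using this
  apply hinj
  simp only [sub_eq_add_neg, ← neg_smul]
  rw [FourierTransform.fourier_add, FourierTransform.fourier_smul]
  ext w
  have h1 : 𝓕 (schwartzResolvent φ) w = ((resolventSymbol w : ℝ) : ℂ) * 𝓕 φ w := by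
    rw [schwartzResolvent, FourierTransform.fourier_fourierInv_eq,
      smulLeftCLM_apply_apply resolventSymbol_hasTemperateGrowth, smul_eq_mul]
  have h2 : 𝓕 (schwartzDeriv2 (schwartzResolvent φ)) w =
      (2 * Real.pi * Complex.I * w) ^ 2 * 𝓕 (schwartzResolvent φ) w :=
    fourier_schwartzDeriv2 _ w
  simp only [_root_.add_apply, _root_.smul_apply, smul_eq_mul, h2, h1]
  have h3 : ((resolventSymbol w : ℝ) : ℂ) = (1 + (w : ℂ) ^ 2)⁻¹ := by
    change (((1 + w ^ 2)⁻¹ : ℝ) : ℂ) = _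
    push_cast; rfl
  have h4 : (1 + (w : ℂ) ^ 2) ≠ 0 := by
    have : (0 : ℝ) < 1 + w ^ 2 := by positivity
    exact_mod_cast this.ne'
  have h5 : (Real.pi : ℂ) ≠ 0 := by exact_mod_cast Real.pi_ne_zero
  rw [h3]
  field_simp
  linear_combination (-(w : ℂ) ^ 2 * 𝓕 φ w) * Complex.I_sq

theorem lineResolvent_inner (g h : LineL2) :
    ⟪lineResolvent g, h⟫_ℂ = ⟪g, lineResolvent h⟫_ℂ := by
  rw [← Lp.inner_fourier_eq, ← Lp.inner_fourier_eq g, lineResolvent, lineResolvent,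
    FourierTransform.fourier_fourierInv_eq, FourierTransform.fourier_fourierInv_eq, mulOp_inner]

theorem continuous_lineResolvent : Continuous lineResolvent :=
  (FourierTransform.continuous_fourierInv).comp
    ((mulOp volume resolventSymbol).continuous.comp FourierTransform.continuous_fourier)

/-- Testing against a Schwartz `φ`, symmetry moves the resolvent onto `φ`. The result `ψ` is again
Schwartz, hence admissible in the weak equation, and `ψ - (2π)⁻² ψ'' = φ`. -/
theorem lineResolvent_of_mem {q : LineL2 × LineL2} (hq : q ∈ lineLaplacianGraph) :
    lineResolvent (q.1 - (((2 * Real.pi) ^ 2)⁻¹ : ℂ) • q.2) = q.1 := by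
  have hd : DenseRange (toLpCLM ℝ ℂ 2 (volume : Measure ℝ)) :=
    denseRange_toLpCLM ENNReal.ofNat_ne_top
  refine hd.eq_of_inner_left ℂ fun φ => ?_
  rw [toLpCLM_apply, lineResolvent_inner, lineResolvent_toLp, inner_sub_left, inner_smul_left,
    ← (mem_lineLaplacianGraph_iff q).1 hq]
  have h1 := congrArg (toLpCLM ℂ ℂ 2 (volume : Measure ℝ)) (schwartzResolvent_spec φ)
  rw [map_sub, map_smul] at h1
  simp only [toLpCLM_apply] at h1
  rw [← h1, inner_sub_right, inner_smul_right]
  have h2 : (starRingEnd ℂ) 2 = 2 := map_ofNat _ 2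
  simp [h2]

/-- The resolvent parametrises the graph continuously by `g ∈ L²`. Schwartz `g` are dense and land
in the Schwartz graph, so Schwartz functions form a core. -/
theorem lineLaplacianGraph_le : lineLaplacianGraph ≤ schwartzGraph.topologicalClosure := by
  intro q hq
  set a : ℂ := (((2 * Real.pi) ^ 2)⁻¹ : ℂ) with ha
  have ha0 : a ≠ 0 := by
    have : (0 : ℝ) < ((2 * Real.pi) ^ 2)⁻¹ := by positivity
    rw [ha]; exact_mod_cast this.ne'
  let F : LineL2 → LineL2 × LineL2 := fun g => (lineResolvent g, a⁻¹ • (lineResolvent g - g))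
  have hF : Continuous F := by
    have := continuous_lineResolvent
    fun_prop
  have hd : DenseRange (toLpCLM ℝ ℂ 2 (volume : Measure ℝ)) :=
    denseRange_toLpCLM ENNReal.ofNat_ne_top
  have key : ∀ g, F g ∈ closure (schwartzGraph : Set (LineL2 × LineL2)) := by
    intro g
    refine hd.induction_on (p := fun g => F g ∈ closure (schwartzGraph : Set (LineL2 × LineL2))) g
      (isClosed_closure.preimage hF) fun φ => subset_closure ?_
    have h1 := schwartzResolvent_spec φ
    rw [sub_eq_iff_eq_add] at h1
    have h2 := congrArg (toLpCLM ℂ ℂ 2 (volume : Measure ℝ)) h1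
    rw [map_add, map_smul] at h2
    simp only [toLpCLM_apply] at h2
    have h3 : F (toLpCLM ℝ ℂ 2 volume φ) = ((schwartzResolvent φ).toLp 2 volume,
        (schwartzDeriv2 (schwartzResolvent φ)).toLp 2 volume) := by
      simp only [F, toLpCLM_apply, lineResolvent_toLp]
      congr 1
      rw [h2, add_sub_cancel_left, smul_smul, inv_mul_cancel₀ ha0, one_smul]
    rw [h3]
    exact mem_schwartzGraph _
  have := key (q.1 - a • q.2)
  have hr : lineResolvent (q.1 - a • q.2) = q.1 := lineResolvent_of_mem hq
  simp only [F, hr] at this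
  rwa [sub_sub_cancel, smul_smul, inv_mul_cancel₀ ha0, one_smul] at this

/-! ### Plancherel for the integral Fourier transform. -/

theorem enorm_sq_eq_lintegral {X : Type*} [MeasurableSpace X] {μ : Measure X} (f : Lp ℂ 2 μ) :
    ‖f‖ₑ ^ 2 = ∫⁻ x, ‖f x‖ₑ ^ 2 ∂μ := by
  rw [Lp.enorm_def, eLpNorm_eq_lintegral_rpow_enorm_toReal (by simp) (by simp),
    ← ENNReal.rpow_natCast, ← ENNReal.rpow_mul]
  simp

/-- Plancherel's theorem for functions in `L¹ ∩ L²`. -/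
theorem lintegral_enorm_fourier_sq {h : ℝ → ℂ} (h1 : Integrable h) (h2 : MemLp h 2) :
    ∫⁻ w, ‖𝓕 h w‖ₑ ^ 2 = ∫⁻ r, ‖h r‖ₑ ^ 2 := by
  have hae : (𝓕 (h2.toLp h) : LineL2) =ᵐ[volume] 𝓕 h := by
    have hcont : Continuous (𝓕 h) := VectorFourier.fourierIntegral_continuous
      Real.continuous_fourierChar (by fun_prop) h1
    -- The L² and integral Fourier transforms agree because both are transposes of the transform on
    -- test functions.
    refine ae_eq_of_integral_contDiff_smul_eq ((Lp.memLp _).locallyIntegrable (by norm_num))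
      hcont.locallyIntegrable fun g hg hgc => ?_
    have hg₁ : HasCompactSupport (Complex.ofRealCLM ∘ g) := hgc.comp_left rfl
    have hg₂ : ContDiff ℝ ∞ (Complex.ofRealCLM ∘ g) := by fun_prop
    set G : 𝓢(ℝ, ℂ) := hg₁.toSchwartzMap hg₂ with hG
    have hGg : ∀ x, G x = (g x : ℂ) := fun x => rfl
    have h3 := DFunLike.congr_fun (Lp.fourier_toTemperedDistribution_eq (h2.toLp h)) G
    rw [TemperedDistribution.fourier_apply, Lp.toTemperedDistribution_apply,
      Lp.toTemperedDistribution_apply] at h3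
    have h4 : ∫ x, 𝓕 G x • h2.toLp h x = ∫ x, 𝓕 (G : ℝ → ℂ) x • h x := by
      refine integral_congr_ae ?_
      filter_upwards [h2.coeFn_toLp] with x hx
      rw [hx, SchwartzMap.fourier_coe]
    have h5 : ∫ x, 𝓕 (G : ℝ → ℂ) x • h x = ∫ x, G x • 𝓕 h x := by
      have := VectorFourier.integral_fourierIntegral_smul_eq_flip (μ := volume) (ν := volume)
        (L := innerₗ ℝ) (e := Real.fourierChar) (f := (G : ℝ → ℂ)) (g := h)
        Real.continuous_fourierChar (by fun_prop) G.integrable h1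
      rw [flip_innerₗ] at this
      exact this
    rw [h4, h5] at h3
    simp only [hGg] at h3
    simpa only [Complex.real_smul, smul_eq_mul] using h3.symm
  calc _ = ∫⁻ w, ‖(𝓕 (h2.toLp h) : LineL2) w‖ₑ ^ 2 := by
        refine lintegral_congr_ae ?_
        filter_upwards [hae] with w hw
        rw [hw]
    _ = ∫⁻ r, ‖h2.toLp h r‖ₑ ^ 2 := by
        rw [← enorm_sq_eq_lintegral, ← enorm_sq_eq_lintegral, ← ofReal_norm, ← ofReal_norm, Lp.norm_fourier_eq]
    _ = _ := by
        refine lintegral_congr_ae ?_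
        filter_upwards [h2.coeFn_toLp] with w hw
        rw [hw]

end Line

/-! ### Resolvent criterion on the line. -/

section LineCriterion

open scoped InnerProductSpace

/-- A point `z` is in the resolvent set of `(d²/dr², ε)` as soon as the pencils at `z` and at its
conjugate are bounded below on Schwartz functions. -/
theorem mem_pairResolventSet_line (ε : ℝ →ᵇ ℝ) {z : ℂ} {c : ℝ} (hc : 0 < c)
    (hz : ∀ φ : 𝓢(ℝ, ℂ), c * ‖φ.toLp 2 volume‖ ≤
      ‖(schwartzDeriv2 φ).toLp 2 volume - z • mulOp volume ε (φ.toLp 2 volume)‖)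
    (hz' : ∀ φ : 𝓢(ℝ, ℂ), c * ‖φ.toLp 2 volume‖ ≤
      ‖(schwartzDeriv2 φ).toLp 2 volume - star z • mulOp volume ε (φ.toLp 2 volume)‖) :
    z ∈ pairResolventSet lineLaplacian (mulOp volume ε) := by
  refine mem_pairResolventSet_of_core lineLaplacian _ (mulOp_inner volume ε) schwartzGraph
    ?_ ?_ ?_ ?_ hc ?_ ?_
  · rw [lineLaplacian_graph]; exact schwartzGraph_le
  · rw [lineLaplacian_graph]; exact lineLaplacianGraph_le
  · intro p hp q hq
    obtain ⟨φ, rfl⟩ := exists_of_mem_schwartzGraph hq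
    exact (mem_lineLaplacianGraph_iff p).1 (schwartzGraph_le hp) φ
  · intro q hq
    rw [lineLaplacian_graph]
    exact (mem_lineLaplacianGraph_iff q).2 fun φ => hq _ (mem_schwartzGraph φ)
  · intro p hp
    obtain ⟨φ, rfl⟩ := exists_of_mem_schwartzGraph hp
    exact hz φ
  · intro p hp
    obtain ⟨φ, rfl⟩ := exists_of_mem_schwartzGraph hp
    exact hz' φ

theorem schwartzGraph_symm (φ : 𝓢(ℝ, ℂ)) :
    ⟪φ.toLp 2 volume, (schwartzDeriv2 φ).toLp 2 volume⟫_ℂ =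
      ⟪(schwartzDeriv2 φ).toLp 2 volume, φ.toLp 2 volume⟫_ℂ :=
  (mem_lineLaplacianGraph_iff _).1 (schwartzGraph_le (mem_schwartzGraph φ)) φ

end LineCriterion

/-! ### Fourier basis of the torus and the lifted pencil. -/

section TorusModes

open scoped InnerProductSpace

variable (T : Fin 2 → ℝ)

theorem torusMode_add (m n : Fin 2 → ℤ) (x : Torus T) :
    torusMode T (m + n) x = torusMode T m x * torusMode T n x := by
  simp only [torusMode, Pi.add_apply, fourier_add, Finset.prod_mul_distrib, ContinuousMap.coe_mk]

theorem torusMode_neg (n : Fin 2 → ℤ) (x : Torus T) :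
    torusMode T (-n) x = star (torusMode T n x) := by
  simp [torusMode, -fourier_apply, fourier_neg]

theorem torusMode_apply_add (n : Fin 2 → ℤ) (x y : Torus T) :
    torusMode T n (x + y) = torusMode T n x * torusMode T n y := by
  simp only [torusMode, ContinuousMap.coe_mk, Pi.add_apply, ← Finset.prod_mul_distrib]
  refine Finset.prod_congr rfl fun i _ => ?_
  simp [fourier_apply, AddCircle.toCircle_add]

theorem norm_torusMode (n : Fin 2 → ℤ) (x : Torus T) : ‖torusMode T n x‖ = 1 := by
  simp only [torusMode, ContinuousMap.coe_mk, norm_prod]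
  exact Finset.prod_eq_one fun i _ => Circle.norm_coe _

theorem torusMode_torusLine (P : Fin 2 → ℝ) (n : Fin 2 → ℤ) (r : ℝ) :
    torusMode T n (torusLine T P r) =
      Complex.exp (Complex.I * ((∑ i, P i * recip T n i : ℝ) * r)) := by
  have := torusMode_coe T n (fun i => P i * r)
  refine Eq.trans this ?_
  congr 2
  rw [← Complex.ofReal_mul, Finset.sum_mul]
  congr 1
  exact Finset.sum_congr rfl fun i _ => by ring

theorem star_blochSymbol_sq (P k : Fin 2 → ℝ) (n : Fin 2 → ℤ) :
    star (blochSymbol T P k n ^ 2) = blochSymbol T P k n ^ 2 := by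
  rw [blochSymbol, ← mul_add, mul_pow, Complex.I_sq, star_mul', star_pow]
  simp

variable [∀ i, Fact (0 < T i)]

theorem integral_torusMode {n : Fin 2 → ℤ} (hn : n ≠ 0) : ∫ x, torusMode T n x = 0 := by
  obtain ⟨i, hi⟩ := Function.ne_iff.1 hn
  -- Translation by half a period of the mode flips its sign, while Haar measure is invariant.
  set y : Torus T := Pi.single i ((T i / 2 / n i : ℝ) : AddCircle (T i)) with hy
  have h1 : torusMode T n y = -1 := by
    simp only [torusMode, ContinuousMap.coe_mk]
    rw [Finset.prod_eq_single i]
    · rw [hy, Pi.single_eq_same]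
      have := fourier_add_half_inv_index (T := T i) hi (Fact.out (p := 0 < T i)) 0
      rw [zero_add] at this
      rw [this, fourier_eval_zero]
    · intro j _ hj
      rw [hy, Pi.single_eq_of_ne hj, fourier_eval_zero]
    · simp
  have h2 := integral_add_right_eq_self (μ := (volume : Measure (Torus T))) (torusMode T n) y
  simp only [torusMode_apply_add, h1, mul_neg, mul_one, integral_neg] at h2
  exact self_eq_neg.1 h2.symm

theorem inner_torusModeLp (m n : Fin 2 → ℤ) :
    ⟪torusModeLp T m, torusModeLp T n⟫_ℂ = ∫ x, torusMode T (n - m) x := by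
  rw [← torusCoeff_eq_inner, torusCoeff]
  refine integral_congr_ae ?_
  filter_upwards [ContinuousMap.coeFn_toLp (p := 2) (𝕜 := ℂ) (volume : Measure (Torus T))
    (torusMode T n)] with x hx
  rw [torusModeLp, hx, sub_eq_add_neg, torusMode_add, torusMode_neg, mul_comm]

theorem norm_torusModeLp_pos (n : Fin 2 → ℤ) : 0 < ‖torusModeLp T n‖ := by
  rw [norm_pos_iff]
  intro h
  have h1 := inner_torusModeLp T n n
  rw [h, inner_zero_left, sub_self] at h1
  have h2 : ∀ x, torusMode T 0 x = 1 := fun x => by simp [torusMode]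
  simp only [h2, integral_const, Complex.real_smul, mul_one] at h1
  have h3 : (0 : ℝ) < (volume : Measure (Torus T)).real Set.univ :=
    ENNReal.toReal_pos (Measure.measure_univ_ne_zero.2 (NeZero.ne _)) (measure_ne_top _ _)
  exact h3.ne (by exact_mod_cast h1)

theorem orthonormal_torusModeLp :
    Orthonormal ℂ fun n => ((‖torusModeLp T n‖ : ℂ)⁻¹) • torusModeLp T n := by
  refine ⟨fun n => ?_, fun m n hmn => ?_⟩
  · rw [norm_smul, norm_inv, Complex.norm_real, norm_norm,
      inv_mul_cancel₀ (norm_torusModeLp_pos T n).ne']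
  · change ⟪_ • _, _ • _⟫_ℂ = 0
    rw [inner_smul_left, inner_smul_right, inner_torusModeLp,
      integral_torusMode T (sub_ne_zero.2 hmn.symm), mul_zero, mul_zero]

/-- The Fourier basis of `L²(𝒯²)`. -/
def torusBasis : HilbertBasis (Fin 2 → ℤ) ℂ (TorusL2 T) :=
  HilbertBasis.mkOfOrthogonalEqBot
    (orthonormal_torusModeLp T)
    (by
      rw [Submodule.eq_bot_iff]
      intro U hU
      refine eq_zero_of_torusCoeff T U fun n => ?_
      have := (Submodule.mem_orthogonal _ _).1 hU _ (Submodule.subset_span ⟨n, rfl⟩)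
      rw [inner_smul_left, mul_eq_zero, ← torusCoeff_eq_inner] at this
      refine this.resolve_left ?_
      simpa using norm_pos_iff.1 (norm_torusModeLp_pos T n))

theorem torusBasis_apply (n : Fin 2 → ℤ) :
    torusBasis T n = ((‖torusModeLp T n‖ : ℂ)⁻¹) • torusModeLp T n := by
  rw [torusBasis, HilbertBasis.coe_mkOfOrthogonalEqBot]

/-- Parseval in the Fourier basis, with a real symbol. -/
theorem torusMultiplierGraph_symm {m : (Fin 2 → ℤ) → ℂ} (hm : ∀ n, star (m n) = m n)
    {p q : TorusL2 T × TorusL2 T} (hp : p ∈ torusMultiplierGraph T m)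
    (hq : q ∈ torusMultiplierGraph T m) : ⟪p.1, q.2⟫_ℂ = ⟪p.2, q.1⟫_ℂ := by
  have hb : ∀ p ∈ torusMultiplierGraph T m, ∀ n,
      ⟪torusBasis T n, p.2⟫_ℂ = m n * ⟪torusBasis T n, p.1⟫_ℂ := by
    intro p hp n
    have h : torusCoeff T n p.2 = m n * torusCoeff T n p.1 := hp n
    simp only [torusBasis_apply, inner_smul_left, ← torusCoeff_eq_inner, h]
    ring
  rw [← (torusBasis T).tsum_inner_mul_inner, ← (torusBasis T).tsum_inner_mul_inner p.2]
  refine tsum_congr fun n => ?_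
  rw [hb q hq n, ← inner_conj_symm p.2, hb p hp n, map_mul, starRingEnd_apply (m n), hm,
    inner_conj_symm]
  ring

theorem liftedLaplacian_graph (P k : Fin 2 → ℝ) :
    (liftedLaplacian T P k).graph = torusMultiplierGraph T fun n => blochSymbol T P k n ^ 2 :=
  torusMultiplier_graph T _

/-- Lower bound for the lifted pencil at a real point away from its spectrum. -/
theorem norm_le_of_ball_subset_torus (P k : Fin 2 → ℝ) (E : C(Torus T, ℝ)) {m : ℝ} (hm : 0 < m)
    (hE : ∀ x, m ≤ E x) {z : ℂ} (hz : star z = z) {δ : ℝ} (hδ : 0 < δ)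
    (hball : Metric.ball z δ ⊆ pairResolventSet (liftedLaplacian T P k)
      (mulOp volume (BoundedContinuousFunction.mkOfCompact E)))
    {U W : TorusL2 T} (hUW : (U, W) ∈ torusMultiplierGraph T fun n => blochSymbol T P k n ^ 2) :
    δ * m * ‖U‖ ≤
      ‖W - z • mulOp volume (BoundedContinuousFunction.mkOfCompact E) U‖ := by
  have hE0 : ∀ x, 0 < E x := fun x => hm.trans_le (hE x)
  let s : Torus T →ᵇ ℝ := BoundedContinuousFunction.mkOfCompact
    ⟨fun x => √(E x), by fun_prop⟩
  let s' : Torus T →ᵇ ℝ := BoundedContinuousFunction.mkOfCompact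
    ⟨fun x => (√(E x))⁻¹, Continuous.inv₀ (by fun_prop) fun x => (Real.sqrt_pos.2 (hE0 x)).ne'⟩
  have hs : ∀ x, s x = √(E x) := fun _ => rfl
  have hs' : ∀ x, s' x = (√(E x))⁻¹ := fun _ => rfl
  have hss : mulOp volume s * mulOp volume s =
      mulOp volume (BoundedContinuousFunction.mkOfCompact E) := by
    rw [mulOp_mul]
    congr 1
    ext x
    simp [hs, Real.mul_self_sqrt (hE0 x).le]
  have h1 : mulOp volume s * mulOp volume s' = 1 := by
    rw [mulOp_mul, ← mulOp_one]
    congr 1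
    ext x
    simp [hs, hs', mul_inv_cancel₀ (Real.sqrt_pos.2 (hE0 x)).ne']
  have h2 : mulOp volume s' * mulOp volume s = 1 := by
    rw [mulOp_mul, mul_comm, ← mulOp_mul, h1]
  -- With `y = s' x`, positivity gives `m ‖y‖² ≤ ⟪y, E y⟫ = ‖s y‖² = ‖x‖²`.
  have hn : ‖mulOp (volume : Measure (Torus T)) s'‖ ≤ (√m)⁻¹ := by
    refine ContinuousLinearMap.opNorm_le_bound _ (by positivity) fun x => ?_
    have h3 := le_re_inner_mulOp (volume : Measure (Torus T))
      (g := BoundedContinuousFunction.mkOfCompact E) hE (mulOp volume s' x)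
    have h4 : mulOp volume s (mulOp volume s' x) = x := DFunLike.congr_fun h1 x
    rw [← hss, mul_apply_eq_comp, ← mulOp_inner, h4] at h3
    have h5 : (⟪x, x⟫_ℂ).re = ‖x‖ ^ 2 := inner_self_eq_norm_sq (𝕜 := ℂ) x
    rw [h5] at h3
    refine abs_le_of_sq_le_sq' ?_ (by positivity) |>.2
    rw [mul_pow, inv_pow, Real.sq_sqrt hm.le, inv_mul_eq_div, le_div_iff₀ hm]
    linarith
  have hgraph : (U, W) ∈ (liftedLaplacian T P k).graph := by
    rw [liftedLaplacian_graph]; exact hUW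
  obtain ⟨u, hu1, hu2⟩ := (LinearPMap.mem_graph_iff _).1 hgraph
  rw [← hss] at hball ⊢
  have h6 := norm_le_of_ball_subset_pairResolventSet (liftedLaplacian T P k) _ _
    (mulOp_isSelfAdjoint volume s) h1 h2 (fun u v => by
      have hu := (liftedLaplacian T P k).mem_graph u
      have hv := (liftedLaplacian T P k).mem_graph v
      rw [liftedLaplacian_graph] at hu hv
      exact torusMultiplierGraph_symm T (star_blochSymbol_sq T P k) hu hv) hz hδ hball u
  rw [hu1, hu2] at h6
  calc δ * m * ‖U‖ ≤ δ * m * (δ⁻¹ * ((√m)⁻¹) ^ 2 *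
        ‖W - z • (mulOp volume s * mulOp volume s) U‖) := by
        gcongr
        refine h6.trans ?_
        gcongr
    _ = _ := by
        rw [inv_pow, Real.sq_sqrt hm.le]
        field_simp

end TorusModes

/-! ### The lift of line functions to the torus. -/

section Transfer

open scoped FourierTransform

variable (T P : Fin 2 → ℝ)

theorem continuous_torusLine : Continuous (torusLine T P) :=
  continuous_pi fun i => (AddCircle.continuous_mk' (T i)).comp (by fun_prop)

/-- The function on `ℝ × 𝒯²` that spreads `u` along the translates of the line `r ↦ P r`,
with profile `φ`, Fourier transformed in the variable along the line. -/
def torusLift (φ : C(Torus T, ℂ)) (u : 𝓢(ℝ, ℂ)) (w : ℝ) (x : Torus T) : ℂ :=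
  𝓕 (fun r : ℝ => u r * φ (x - torusLine T P r)) w

variable (φ : C(Torus T, ℂ)) (u v : 𝓢(ℝ, ℂ))

theorem continuous_fiber :
    Continuous fun p : ℝ × Torus T => u p.1 * φ (p.2 - torusLine T P p.1) := by
  have := continuous_torusLine T P
  have := u.continuous
  fun_prop

theorem torusLift_eq (w : ℝ) (x : Torus T) : torusLift T P φ u w x =
    ∫ r : ℝ, (Real.fourierChar (-(r * w)) : ℂ) * (u r * φ (x - torusLine T P r)) := by
  rw [torusLift, Real.fourier_real_eq]
  rfl

variable [∀ i, Fact (0 < T i)]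

theorem memLp_fiber (x : Torus T) (p : ℝ≥0∞) :
    MemLp (fun r : ℝ => u r * φ (x - torusLine T P r)) p := by
  refine MemLp.of_le_mul (c := ‖φ‖) (u.memLp p)
    ((continuous_fiber T P φ u).comp (by fun_prop : Continuous fun r : ℝ => (r, x))
      ).aestronglyMeasurable (Filter.Eventually.of_forall fun r => ?_)
  rw [norm_mul, mul_comm]
  gcongr
  exact φ.norm_coe_le_norm _

theorem integrable_fiber (x : Torus T) :
    Integrable (fun r : ℝ => u r * φ (x - torusLine T P r)) :=
  memLp_one_iff_integrable.1 (memLp_fiber T P φ u x 1)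

theorem continuous_torusLift : Continuous fun p : ℝ × Torus T => torusLift T P φ u p.1 p.2 := by
  simp only [torusLift_eq]
  refine continuous_of_dominated (bound := fun r => ‖u r‖ * ‖φ‖) (fun p => ?_) (fun p => ?_)
    (u.integrable.norm.mul_const _) (Filter.Eventually.of_forall fun r => ?_)
  · have := continuous_torusLine T P
    have := u.continuous
    exact Continuous.aestronglyMeasurable (by fun_prop)
  · refine Filter.Eventually.of_forall fun r => ?_
    rw [norm_mul, Circle.norm_coe, one_mul, norm_mul]
    gcongr
    exact φ.norm_coe_le_norm _
  · fun_prop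

theorem torusLift_sub_smul (c : ℂ) (w : ℝ) (x : Torus T) :
    torusLift T P φ (u - c • v) w x = torusLift T P φ u w x - c * torusLift T P φ v w x := by
  have h : ∀ u : 𝓢(ℝ, ℂ), Integrable fun r : ℝ =>
      (Real.fourierChar (-(r * w)) : ℂ) * (u r * φ (x - torusLine T P r)) := fun u => by
    have := (Real.fourierIntegral_convergent_iff w).2 (integrable_fiber T P φ u x)
    simpa only [RCLike.inner_apply, conj_trivial, mul_comm w, Circle.smul_def, smul_eq_mul]
      using this
  rw [torusLift_eq, torusLift_eq, torusLift_eq, ← integral_const_mul, ← integral_sub (h u)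
    ((h v).const_mul c)]
  refine integral_congr_ae (Filter.Eventually.of_forall fun r => ?_)
  simp
  ring

theorem lintegral_torusLift (x : Torus T) :
    ∫⁻ w, ‖torusLift T P φ u w x‖ₑ ^ 2 =
      ∫⁻ r, ‖u r‖ₑ ^ 2 * ‖φ (x - torusLine T P r)‖ₑ ^ 2 := by
  simp only [torusLift]
  rw [lintegral_enorm_fourier_sq (integrable_fiber T P φ u x) (memLp_fiber T P φ u x 2)]
  simp only [enorm_mul, mul_pow]

/-- The modulated lift as a continuous function on the torus. -/
def torusLiftMod (n₀ : Fin 2 → ℤ) (w : ℝ) : C(Torus T, ℂ) where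
  toFun x := torusMode T n₀ x * torusLift T P φ u w x
  continuous_toFun := by
    have := (continuous_torusLift T P φ u).comp (by fun_prop : Continuous fun x => (w, x))
    exact (torusMode T n₀).continuous.mul this

theorem torusCoeff_toLp (n : Fin 2 → ℤ) (G : C(Torus T, ℂ)) :
    torusCoeff T n (ContinuousMap.toLp (E := ℂ) 2 volume ℂ G) =
      ∫ x, torusMode T (-n) x * G x := by
  rw [torusCoeff]
  refine integral_congr_ae ?_
  filter_upwards [ContinuousMap.coeFn_toLp (p := 2) (𝕜 := ℂ) (volume : Measure (Torus T)) G]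
    with x hx
  rw [hx, torusMode_neg]

theorem torusCoeff_torusLiftMod (n n₀ : Fin 2 → ℤ) (w : ℝ) :
    torusCoeff T n (ContinuousMap.toLp (E := ℂ) 2 volume ℂ (torusLiftMod T P φ u n₀ w)) =
      (∫ y, torusMode T (n₀ - n) y * φ y) *
        𝓕 (u : ℝ → ℂ) (w - (∑ i, P i * recip T (n₀ - n) i) / (2 * Real.pi)) := by
  have h1 : ∀ x, torusMode T (-n) x * torusLiftMod T P φ u n₀ w x =
      ∫ r : ℝ, torusMode T (n₀ - n) x *
        ((Real.fourierChar (-(r * w)) : ℂ) * (u r * φ (x - torusLine T P r))) := by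
    intro x
    rw [integral_const_mul, ← torusLift_eq, sub_eq_add_neg, torusMode_add]
    change _ * (torusMode T n₀ x * torusLift T P φ u w x) = _
    ring
  rw [torusCoeff_toLp]
  simp only [h1]
  rw [integral_integral_swap]
  · have h2 : ∀ r : ℝ, ∫ x, torusMode T (n₀ - n) x *
        ((Real.fourierChar (-(r * w)) : ℂ) * (u r * φ (x - torusLine T P r))) =
        (∫ y, torusMode T (n₀ - n) y * φ y) *
          ((Real.fourierChar (-(r * (w - (∑ i, P i * recip T (n₀ - n) i) / (2 * Real.pi)))) : ℂ)
            * u r) := by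
      intro r
      -- Substituting `x = y + P r` separates the variables: `φ` depends on `y` alone, and the mode
      -- contributes a character of `r` that shifts the frequency.
      rw [← integral_add_right_eq_self _ (torusLine T P r), ← integral_mul_const]
      refine integral_congr_ae (Filter.Eventually.of_forall fun y => ?_)
      simp only [add_sub_cancel_right, torusMode_apply_add, torusMode_torusLine]
      have h3 : (Real.fourierChar
          (-(r * (w - (∑ i, P i * recip T (n₀ - n) i) / (2 * Real.pi)))) : ℂ) =
          Complex.exp (Complex.I * ((∑ i, P i * recip T (n₀ - n) i : ℝ) * r)) *
            Real.fourierChar (-(r * w)) := by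
        rw [Real.fourierChar_apply, Real.fourierChar_apply, ← Complex.exp_add]
        congr 1
        have : (Real.pi : ℂ) ≠ 0 := by exact_mod_cast Real.pi_ne_zero
        push_cast
        field_simp
        ring
      rw [h3]
      ring
    simp only [h2]
    rw [integral_const_mul, Real.fourier_real_eq]
    rfl
  · have hb : Integrable (fun p : Torus T × ℝ => ‖φ‖ * ‖u p.2‖)
        ((volume : Measure (Torus T)).prod volume) :=
      (integrable_const ‖φ‖).mul_prod u.integrable.norm
    refine hb.mono' ?_ (Filter.Eventually.of_forall fun p => ?_)
    · have := continuous_torusLine T P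
      have := u.continuous
      have := (torusMode T (n₀ - n)).continuous
      refine Continuous.aestronglyMeasurable ?_
      simp only [Function.uncurry_def]
      fun_prop
    · simp only [Function.uncurry_def]
      rw [norm_mul, norm_torusMode, one_mul, norm_mul, Circle.norm_coe, one_mul, norm_mul, mul_comm]
      gcongr
      exact φ.norm_coe_le_norm _

/-- The `n`-th coefficient samples the transform of `u` at frequency `Pᵀ(k + ξₙ) / 2π`, where the
symbol of `d²/dr²` is exactly the squared Bloch symbol. -/
theorem torusLiftMod_mem_graph {k : Fin 2 → ℝ} {n₀ : Fin 2 → ℤ} {w : ℝ}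
    (hk : 2 * Real.pi * w = ∑ i, P i * (k i + recip T n₀ i)) :
    (ContinuousMap.toLp (E := ℂ) 2 volume ℂ (torusLiftMod T P φ u n₀ w),
      ContinuousMap.toLp (E := ℂ) 2 volume ℂ (torusLiftMod T P φ (schwartzDeriv2 u) n₀ w)) ∈
      torusMultiplierGraph T fun n => blochSymbol T P k n ^ 2 := by
  intro n
  simp only [torusCoeff_torusLiftMod, fourier_schwartzDeriv2]
  have h : (2 * Real.pi * Complex.I *
      ((w - (∑ i, P i * recip T (n₀ - n) i) / (2 * Real.pi) : ℝ) : ℂ)) =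
      blochSymbol T P k n := by
    have h1 : 2 * Real.pi * (w - (∑ i, P i * recip T (n₀ - n) i) / (2 * Real.pi)) =
        ∑ i, P i * recip T n i + ∑ i, P i * k i := by
      have : Real.pi ≠ 0 := Real.pi_ne_zero
      have h2 : ∑ i, P i * recip T (n₀ - n) i =
          ∑ i, P i * recip T n₀ i - ∑ i, P i * recip T n i := by
        rw [← Finset.sum_sub_distrib]
        refine Finset.sum_congr rfl fun i _ => ?_
        simp only [recip, Pi.sub_apply]
        push_cast
        ring
      rw [mul_sub, hk, mul_div_cancel₀ _ (by positivity), h2]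
      simp only [mul_add, Finset.sum_add_distrib]
      ring
    rw [blochSymbol, ← mul_add, ← Complex.ofReal_add, ← h1]
    push_cast
    ring
  rw [h]
  ring

/-- Every frequency is attained by a Bloch vector in the Brillouin zone, up to a reciprocal
lattice vector. -/
theorem exists_brillouinZone (hP : P ≠ 0) (θ : ℝ) :
    ∃ k ∈ brillouinZone T, ∃ n : Fin 2 → ℤ, θ = ∑ i, P i * (k i + recip T n i) := by
  have hS : ∑ i, P i * P i ≠ 0 := by
    intro h
    apply hP
    ext i
    have := (Finset.sum_eq_zero_iff_of_nonneg fun i _ => mul_self_nonneg (P i)).1 h i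
      (Finset.mem_univ i)
    simpa using this
  -- The multiple of `P` with `Pᵀκ = θ`; rounding it to the nearest reciprocal lattice vector leaves
  -- a remainder in the Brillouin zone.
  let κ : Fin 2 → ℝ := fun i => θ * P i / ∑ i, P i * P i
  let n : Fin 2 → ℤ := fun i => round (κ i * T i / (2 * Real.pi))
  refine ⟨fun i => κ i - recip T n i, fun i => ?_, n, ?_⟩
  · have hT : 0 < T i := Fact.out
    have h1 := abs_le.1 (abs_sub_round (κ i * T i / (2 * Real.pi)))
    have h2 : κ i - recip T n i =
        (κ i * T i / (2 * Real.pi) - round (κ i * T i / (2 * Real.pi))) *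
          (2 * (Real.pi / T i)) := by
      simp only [recip, n]
      have := Real.pi_ne_zero
      field_simp
    have h3 : 0 < Real.pi / T i := by positivity
    change κ i - recip T n i ∈ _
    rw [h2]
    constructor <;> nlinarith [h1.1, h1.2]
  · simp only [sub_add_cancel, κ]
    have : ∀ i, P i * (θ * P i / ∑ i, P i * P i) = (P i * P i) * (θ / ∑ i, P i * P i) :=
      fun i => by ring
    simp only [this]
    rw [← Finset.sum_mul, mul_div_cancel₀ _ hS]

variable (E : C(Torus T, ℝ))

theorem enorm_sq_torusLiftMod (n₀ : Fin 2 → ℤ) (w : ℝ) :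
    ‖ContinuousMap.toLp (E := ℂ) 2 volume ℂ (torusLiftMod T P φ u n₀ w)‖ₑ ^ 2 =
      ∫⁻ x, ‖torusLift T P φ u w x‖ₑ ^ 2 := by
  rw [enorm_sq_eq_lintegral]
  refine lintegral_congr_ae ?_
  filter_upwards [ContinuousMap.coeFn_toLp (p := 2) (𝕜 := ℂ) (volume : Measure (Torus T))
    (torusLiftMod T P φ u n₀ w)] with x hx
  rw [hx]
  change ‖torusMode T n₀ x * torusLift T P φ u w x‖ₑ ^ 2 = _
  rw [enorm_mul, ← ofReal_norm, norm_torusMode, ENNReal.ofReal_one, one_mul]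

theorem enorm_sq_pencil_torusLiftMod (z : ℂ) (n₀ : Fin 2 → ℤ) (w : ℝ) :
    ‖ContinuousMap.toLp (E := ℂ) 2 volume ℂ (torusLiftMod T P φ v n₀ w) -
      z • mulOp volume (BoundedContinuousFunction.mkOfCompact E)
        (ContinuousMap.toLp (E := ℂ) 2 volume ℂ (torusLiftMod T P φ u n₀ w))‖ₑ ^ 2 =
      ∫⁻ x, ‖torusLift T P φ (v - (z * E x) • u) w x‖ₑ ^ 2 := by
  rw [enorm_sq_eq_lintegral]
  refine lintegral_congr_ae ?_
  set U := ContinuousMap.toLp (E := ℂ) 2 volume ℂ (torusLiftMod T P φ u n₀ w) with hU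
  set V := ContinuousMap.toLp (E := ℂ) 2 volume ℂ (torusLiftMod T P φ v n₀ w) with hV
  filter_upwards [ContinuousMap.coeFn_toLp (p := 2) (𝕜 := ℂ) (volume : Measure (Torus T))
    (torusLiftMod T P φ u n₀ w), ContinuousMap.coeFn_toLp (p := 2) (𝕜 := ℂ)
    (volume : Measure (Torus T)) (torusLiftMod T P φ v n₀ w),
    mulOp_ae volume (BoundedContinuousFunction.mkOfCompact E) U,
    Lp.coeFn_sub V (z • mulOp volume (BoundedContinuousFunction.mkOfCompact E) U),
    Lp.coeFn_smul z (mulOp volume (BoundedContinuousFunction.mkOfCompact E) U)]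
    with x h1 h2 h3 h4 h5
  rw [h4, Pi.sub_apply, h5, Pi.smul_apply, h3, hU, hV, h1, h2, torusLift_sub_smul]
  have : torusMode T n₀ x * torusLift T P φ v w x -
      z • ((E x : ℂ) * (torusMode T n₀ x * torusLift T P φ u w x)) =
      torusMode T n₀ x *
        (torusLift T P φ v w x - z * E x * torusLift T P φ u w x) := by
    simp only [smul_eq_mul]; ring
  change ‖torusMode T n₀ x * torusLift T P φ v w x -
      z • ((E x : ℂ) * (torusMode T n₀ x * torusLift T P φ u w x))‖ₑ ^ 2 = _
  rw [this, enorm_mul, ← ofReal_norm, norm_torusMode, ENNReal.ofReal_one, one_mul]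

theorem measurable_torusLift : Measurable fun p : ℝ × Torus T => torusLift T P φ u p.1 p.2 :=
  (continuous_torusLift T P φ u).measurable

/-- Plancherel along the line, then Tonelli and translation invariance decouple `u` from `φ`. -/
theorem lintegral_lintegral_torusLift :
    ∫⁻ w, ∫⁻ x, ‖torusLift T P φ u w x‖ₑ ^ 2 =
      (∫⁻ r, ‖u r‖ₑ ^ 2) * ∫⁻ y, ‖φ y‖ₑ ^ 2 := by
  rw [lintegral_lintegral_swap]
  · simp only [lintegral_torusLift]
    rw [lintegral_lintegral_swap]
    · have h : ∀ r : ℝ, ∫⁻ x, ‖u r‖ₑ ^ 2 * ‖φ (x - torusLine T P r)‖ₑ ^ 2 =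
          ‖u r‖ₑ ^ 2 * ∫⁻ y, ‖φ y‖ₑ ^ 2 := by
        intro r
        rw [lintegral_const_mul' _ _ (by finiteness),
          lintegral_sub_right_eq_self (fun x => ‖φ x‖ₑ ^ 2) (torusLine T P r)]
      simp only [h]
      rw [lintegral_mul_const]
      exact (u.continuous.measurable.enorm).pow_const 2
    · have := continuous_torusLine T P
      have := u.continuous
      refine Measurable.aemeasurable ?_
      simp only [Function.uncurry_def]
      refine ((Continuous.measurable (by fun_prop)).enorm.pow_const 2).mul
        ((Continuous.measurable (by fun_prop)).enorm.pow_const 2)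
  · exact ((measurable_torusLift T P φ u).enorm.pow_const 2).aemeasurable

/-- For fixed `x` the coefficient `E x` is a scalar, so Plancherel in `r` applies. Only the later
substitution `x = y + P r` turns it into the variable coefficient on the line through `y`. -/
theorem lintegral_lintegral_torusLift_pencil (z : ℂ) :
    ∫⁻ w, ∫⁻ x, ‖torusLift T P φ (v - (z * E x) • u) w x‖ₑ ^ 2 =
      ∫⁻ y, ‖φ y‖ₑ ^ 2 * ∫⁻ r, ‖v r - z * E (y + torusLine T P r) * u r‖ₑ ^ 2 := by
  have hl := continuous_torusLine T P
  have hu := u.continuous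
  have hv := v.continuous
  rw [lintegral_lintegral_swap]
  · simp only [lintegral_torusLift]
    have h0 : ∀ (x : Torus T) (r : ℝ), (v - (z * E x) • u) r = v r - z * E x * u r :=
      fun x r => rfl
    simp only [h0]
    rw [lintegral_lintegral_swap]
    · have h : ∀ r : ℝ, ∫⁻ x, ‖v r - z * E x * u r‖ₑ ^ 2 * ‖φ (x - torusLine T P r)‖ₑ ^ 2 =
          ∫⁻ y, ‖φ y‖ₑ ^ 2 * ‖v r - z * E (y + torusLine T P r) * u r‖ₑ ^ 2 := by
        intro r
        rw [← lintegral_add_right_eq_self _ (torusLine T P r)]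
        simp only [add_sub_cancel_right, mul_comm]
      simp only [h]
      rw [lintegral_lintegral_swap]
      · refine lintegral_congr fun y => ?_
        rw [lintegral_const_mul' _ _ (by finiteness)]
      · refine Measurable.aemeasurable ?_
        simp only [Function.uncurry_def]
        refine ((Continuous.measurable (by fun_prop)).enorm.pow_const 2).mul
          ((Continuous.measurable (by fun_prop)).enorm.pow_const 2)
    · refine Measurable.aemeasurable ?_
      simp only [Function.uncurry_def]
      refine ((Continuous.measurable (by fun_prop)).enorm.pow_const 2).mul
        ((Continuous.measurable (by fun_prop)).enorm.pow_const 2)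
  · refine Measurable.aemeasurable ?_
    simp only [Function.uncurry_def, torusLift_sub_smul]
    have h1 := continuous_torusLift T P φ u
    have h2 := continuous_torusLift T P φ v
    exact (Continuous.measurable (by fun_prop)).enorm.pow_const 2

end Transfer

/-! ### Transference from the torus to the line. -/

section Transfer

variable (T P : Fin 2 → ℝ) [∀ i, Fact (0 < T i)] (E : C(Torus T, ℝ))

/-- The restriction of `E` to the line through `y` with direction `P`. -/
def lineRestrict (y : Torus T) : ℝ →ᵇ ℝ :=
  (BoundedContinuousFunction.mkOfCompact E).compContinuous
    ⟨fun r => y + torusLine T P r, by have := continuous_torusLine T P; fun_prop⟩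

theorem lineRestrict_apply (y : Torus T) (r : ℝ) :
    lineRestrict T P E y r = E (y + torusLine T P r) := rfl

theorem norm_mulOp_le {X : Type*} [TopologicalSpace X] [MeasurableSpace X]
    [OpensMeasurableSpace X] (μ : Measure X) {g : X →ᵇ ℝ} {η : ℝ}
    (hη : ∀ x, |g x| ≤ η) (u : Lp ℂ 2 μ) : ‖mulOp μ g u‖ ≤ η * ‖u‖ := by
  refine Lp.norm_le_mul_norm_of_ae_le_mul ?_
  filter_upwards [mulOp_ae μ g u] with x hx
  rw [hx, norm_mul, Complex.norm_real, Real.norm_eq_abs]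
  gcongr
  exact hη x

theorem enorm_sq_pencil_line (z : ℂ) (g : ℝ →ᵇ ℝ) (u v : 𝓢(ℝ, ℂ)) :
    ‖v.toLp 2 volume - z • mulOp volume g (u.toLp 2 volume)‖ₑ ^ 2 =
      ∫⁻ r, ‖v r - z * g r * u r‖ₑ ^ 2 := by
  rw [enorm_sq_eq_lintegral]
  refine lintegral_congr_ae ?_
  filter_upwards [u.coeFn_toLp 2 volume, v.coeFn_toLp 2 volume,
    mulOp_ae volume g (u.toLp 2 volume),
    Lp.coeFn_sub (v.toLp 2 volume) (z • mulOp volume g (u.toLp 2 volume)),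
    Lp.coeFn_smul z (mulOp volume g (u.toLp 2 volume))] with x h1 h2 h3 h4 h5
  rw [h4, Pi.sub_apply, h5, Pi.smul_apply, h3, h1, h2, smul_eq_mul, mul_assoc]

/-- A tent function at `0`; its nonzero finite L² mass can be cancelled from the averaged
inequality. -/
theorem exists_profile {ρ : ℝ} (hρ : 0 < ρ) :
    ∃ φ : C(Torus T, ℂ), (∀ y, φ y ≠ 0 → dist y 0 < ρ) ∧
      ∫⁻ y, ‖φ y‖ₑ ^ 2 ≠ 0 ∧ ∫⁻ y, ‖φ y‖ₑ ^ 2 ≠ ∞ := by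
  let φ : C(Torus T, ℂ) := ⟨fun y => ((max 0 (ρ - dist y 0) : ℝ) : ℂ), by fun_prop⟩
  have hφ : ∀ y, φ y = ((max 0 (ρ - dist y 0) : ℝ) : ℂ) := fun _ => rfl
  refine ⟨φ, fun y hy => ?_, ?_, ?_⟩
  · by_contra! h
    apply hy
    rw [hφ, max_eq_left (by linarith), Complex.ofReal_zero]
  · have hc : Continuous fun y => ‖φ y‖ₑ ^ 2 := by fun_prop
    rw [Ne, lintegral_eq_zero_iff hc.measurable, hc.ae_eq_iff_eq volume continuous_zero]
    intro h
    have := congrFun h 0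
    simp only [Pi.zero_apply, pow_eq_zero_iff two_ne_zero, enorm_eq_zero, hφ, dist_self, sub_zero,
      max_eq_right hρ.le, Complex.ofReal_eq_zero] at this
    exact hρ.ne' this
  · rw [← lt_top_iff_ne_top]
    calc _ ≤ ∫⁻ _ : Torus T, ‖φ‖ₑ ^ 2 := by
          refine lintegral_mono fun y => ?_
          gcongr
          rw [← ofReal_norm, ← ofReal_norm]
          exact ENNReal.ofReal_le_ofReal (φ.norm_coe_le_norm y)
      _ < ∞ := by
          rw [lintegral_const]
          exact ENNReal.mul_lt_top (by finiteness) (measure_lt_top _ _)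

/-- Transference: uniform lower bounds for the lifted pencils over the Brillouin zone give the same
lower bound for the pencil on the line, on Schwartz functions. -/
theorem line_bound_of_torus_bound (hP : P ≠ 0) (ε : ℝ →ᵇ ℝ)
    (hε : ∀ r, ε r = E (torusLine T P r)) {z : ℂ} {c : ℝ} (hc : 0 < c)
    (hb : ∀ k ∈ brillouinZone T, ∀ U W : TorusL2 T,
      (U, W) ∈ torusMultiplierGraph T (fun n => blochSymbol T P k n ^ 2) →
      c * ‖U‖ ≤ ‖W - z • mulOp volume (BoundedContinuousFunction.mkOfCompact E) U‖)
    (u : 𝓢(ℝ, ℂ)) :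
    c * ‖u.toLp 2 volume‖ ≤
      ‖(schwartzDeriv2 u).toLp 2 volume - z • mulOp volume ε (u.toLp 2 volume)‖ := by
  set u₀ : LineL2 := u.toLp 2 volume with hu₀
  set v₀ : LineL2 := (schwartzDeriv2 u).toLp 2 volume with hv₀
  have key : ∀ η : ℝ, 0 < η →
      c * ‖u₀‖ ≤ ‖v₀ - z • mulOp volume ε u₀‖ + ‖z‖ * (η * ‖u₀‖) := by
    intro η hη
    set M : ℝ := ‖v₀ - z • mulOp volume ε u₀‖ + ‖z‖ * (η * ‖u₀‖) with hM
    have hM0 : 0 ≤ M := by positivity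
    obtain ⟨ρ, hρ, hρE⟩ := Metric.uniformContinuous_iff.1
      (CompactSpace.uniformContinuous_of_continuous E.continuous) η hη
    obtain ⟨φ, hφ, hφ0, hφtop⟩ := exists_profile T hρ
    -- Each frequency selects its own `k` and `n₀`. The unimodular modulation drops out of the
    -- norms, so no measurable choice is needed before integrating in `w`.
    have h1 : ∀ w : ℝ, ENNReal.ofReal c ^ 2 * ∫⁻ x, ‖torusLift T P φ u w x‖ₑ ^ 2 ≤
        ∫⁻ x, ‖torusLift T P φ (schwartzDeriv2 u - (z * E x) • u) w x‖ₑ ^ 2 := by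
      intro w
      obtain ⟨k, hk, n₀, hkn⟩ := exists_brillouinZone T P hP (2 * Real.pi * w)
      have := hb k hk _ _ (torusLiftMod_mem_graph T P φ u hkn)
      rw [← enorm_sq_torusLiftMod T P φ u n₀, ← enorm_sq_pencil_torusLiftMod T P φ u _ E z n₀,
        ← mul_pow]
      gcongr
      rw [← ofReal_norm, ← ofReal_norm, ← ENNReal.ofReal_mul hc.le]
      exact ENNReal.ofReal_le_ofReal this
    have h2 := lintegral_mono (μ := (volume : Measure ℝ)) h1
    rw [lintegral_const_mul' _ _ (by finiteness), lintegral_lintegral_torusLift,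
      lintegral_lintegral_torusLift_pencil] at h2
    have h3 : ∫⁻ y, ‖φ y‖ₑ ^ 2 *
        ∫⁻ r, ‖schwartzDeriv2 u r - z * E (y + torusLine T P r) * u r‖ₑ ^ 2 ≤
        (∫⁻ y, ‖φ y‖ₑ ^ 2) * ENNReal.ofReal M ^ 2 := by
      rw [← lintegral_mul_const' _ _ (by finiteness)]
      refine lintegral_mono fun y => ?_
      by_cases hy : φ y = 0
      · simp [hy]
      gcongr
      have h4 := enorm_sq_pencil_line z (lineRestrict T P E y) u (schwartzDeriv2 u)
      simp only [lineRestrict_apply] at h4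
      rw [← h4, ← ofReal_norm]
      gcongr
      have h5 : mulOp volume (lineRestrict T P E y) u₀ =
          mulOp volume ε u₀ + mulOp volume (lineRestrict T P E y - ε) u₀ := by
        refine Lp.ext ?_
        filter_upwards [mulOp_ae volume (lineRestrict T P E y) u₀, mulOp_ae volume ε u₀,
          mulOp_ae volume (lineRestrict T P E y - ε) u₀,
          Lp.coeFn_add (mulOp volume ε u₀) (mulOp volume (lineRestrict T P E y - ε) u₀)]
          with x a1 a2 a3 a4
        rw [a4, Pi.add_apply, a1, a2, a3]
        simp
        ring
      have h6 : ‖mulOp volume (lineRestrict T P E y - ε) u₀‖ ≤ η * ‖u₀‖ := by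
        refine norm_mulOp_le _ (fun r => ?_) _
        rw [BoundedContinuousFunction.sub_apply, lineRestrict_apply, hε, ← Real.dist_eq]
        refine (hρE ?_).le
        rw [dist_eq_norm, add_sub_cancel_right, ← dist_zero_right]
        exact hφ y hy
      rw [← hu₀, ← hv₀, h5, smul_add, ← sub_sub]
      refine (norm_sub_le _ _).trans ?_
      rw [norm_smul, hM]
      gcongr
    have h7 := h2.trans h3
    rw [← mul_assoc, mul_comm _ (∫⁻ y, ‖φ y‖ₑ ^ 2),
      ENNReal.mul_le_mul_iff_right hφ0 hφtop] at h7
    have h8 : ∫⁻ r, ‖u r‖ₑ ^ 2 = ‖u₀‖ₑ ^ 2 := by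
      rw [enorm_sq_eq_lintegral]
      refine lintegral_congr_ae ?_
      filter_upwards [u.coeFn_toLp 2 volume] with x hx
      rw [hu₀, hx]
    rw [h8, ← mul_pow, ← ofReal_norm, ← ENNReal.ofReal_mul hc.le,
      ← ENNReal.ofReal_pow (by positivity), ← ENNReal.ofReal_pow hM0,
      ENNReal.ofReal_le_ofReal_iff (by positivity)] at h7
    exact abs_le_of_sq_le_sq' h7 hM0 |>.2
  refine le_of_forall_pos_le_add fun t ht => ?_
  -- This `η` makes the error at most `t`; the `+ 1` covers `‖z‖ * ‖u₀‖ = 0`.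
  have := key (t / (‖z‖ * ‖u₀‖ + 1)) (by positivity)
  refine this.trans ?_
  gcongr
  rw [mul_left_comm, div_mul_eq_mul_div, div_le_iff₀ (by positivity)]
  nlinarith [ht]

end Transfer

end

/-- The spectrum of `(∇_r², ε)` on `L²(ℝ)` is contained in the closure of the union, over the Bloch
vectors `k` of the Brillouin zone, of the spectra of `((∇_P + i Pᵀ k)², 𝓔)` on `L²(𝒯²)`. -/
theorem mainTheorem3
    (T : Fin 2 → ℝ) [∀ i, Fact (0 < T i)]
    (P : Fin 2 → ℝ) (hP : LinearIndependent ℚ P)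
    (E : C(Torus T, ℝ)) (hE : ∀ x, 0 < E x)
    (ε : ℝ →ᵇ ℝ) (hε : ∀ r, ε r = E (torusLine T P r)) :
    pairSpectrum lineLaplacian (mulOp volume ε) ⊆
      closure (⋃ k ∈ brillouinZone T,
        pairSpectrum (liftedLaplacian T P k)
          (mulOp volume (BoundedContinuousFunction.mkOfCompact E))) := by
  obtain ⟨m, hm, hmE⟩ : ∃ m : ℝ, 0 < m ∧ ∀ x, m ≤ E x := by
    obtain ⟨x₀, -, hx₀⟩ := isCompact_univ.exists_isMinOn Set.univ_nonempty E.continuous.continuousOn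
    exact ⟨E x₀, hE x₀, fun x => hx₀ (Set.mem_univ x)⟩
  have hP0 : P ≠ 0 := fun h => hP.ne_zero 0 (congrFun h 0)
  intro z hz
  by_contra hcl
  apply hz
  -- The spectral radius argument needs `z` real; off the real axis symmetry alone gives the bound.
  by_cases him : z.im = 0
  · have hzs : star z = z := Complex.conj_eq_iff_im.2 him
    obtain ⟨δ, hδ, hball⟩ : ∃ δ > 0, ∀ k ∈ brillouinZone T, Metric.ball z δ ⊆
        pairResolventSet (liftedLaplacian T P k)
          (mulOp volume (BoundedContinuousFunction.mkOfCompact E)) := by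
      simp only [Metric.mem_closure_iff, not_forall, not_exists, not_and, not_lt] at hcl
      obtain ⟨δ, hδ, h⟩ := hcl
      refine ⟨δ, hδ, fun k hk w hw => ?_⟩
      by_contra hw'
      have := h w (Set.mem_biUnion hk hw')
      rw [Metric.mem_ball, dist_comm] at hw
      exact absurd hw (not_lt.2 this)
    have hb := line_bound_of_torus_bound T P E hP0 ε hε (z := z) (mul_pos hδ hm)
      fun k hk U W hUW => norm_le_of_ball_subset_torus T P k E hm hmE hzs hδ (hball k hk) hUW
    exact mem_pairResolventSet_line ε (mul_pos hδ hm) hb (by rw [hzs]; exact hb)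
  · have hpos : 0 < |z.im| * m := mul_pos (abs_pos.2 him) hm
    have hre := le_re_inner_mulOp (volume : Measure ℝ) (g := ε) (m := m)
      fun r => by rw [hε]; exact hmE _
    refine mem_pairResolventSet_line ε hpos (fun φ => ?_) fun φ => ?_
    · exact abs_im_mul_norm_le hre (mulOp_inner volume ε) (schwartzGraph_symm φ) z
    · have := abs_im_mul_norm_le hre (mulOp_inner volume ε) (schwartzGraph_symm φ) (star z)
      simpa using this
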